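/- **Setting.** Let $n=l+m$ with $l\ge 1$, and let $\mathbf A=(A_1,\dots,A_n)$ be a tuple of finite sets $A_i\subset\mathbb R^n=\mathbb R^l\times\mathbb R^{m}$, $A_i-A_i\subset\mathbb Z^n$, whose elements are written as row vectors $\mathbf a=[\mathbf b\ \mathbf c]$. For $\boldsymbol\xi\in\mathbb R^n$ let $A_i^{\boldsymbol\xi}$ be the set of $\mathbf a\in A_i$ with $\mathbf a\boldsymbol\xi$ maximal; the outer fan of $\mathbf A$ is the set of closures of the non-empty cones $\{\boldsymbol\xi: A_i^{\boldsymbol\xi}=B_i\ \forall i\}$, $\emptyset\neq B_i\subset A_i$. Assume that $\mathbf A$ is in *normal form*: $\mathbf b\ge 0$ for all $[\mathbf b\ \mathbf c]\in A_i$; each $A_i$ has an element with $\mathbf b=0$; $\sum_{[\mathbf 0\,\mathbf c]\in A_i}\mathbf c=0$ for each $i$; the half-lines $\mathrm{Cone}(-\mathrm e_1),\dots,\mathrm{Cone}(-\mathrm e_n)$ belong to the outer fan; and some $n$-dimensional cone of the outer fan contains $-\mathrm e_1,\dots,-\mathrm e_n$. For $(\mathbf X,\mathbf y)\in\mathbb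 C^l\times\mathbb C^{m}$ let $\Omega_{A_i}(\mathbf X,\mathbf y)=(\mathbf X^{\mathbf b}e^{\mathbf c\mathbf y})_{[\mathbf b\,\mathbf c]\in A_i}$, $\omega_i=\Omega_{A_i}(\mathbf 0,\mathbf 0)$, and let $\|\mathbf u\|_{\omega}=\|D[\boldsymbol\Omega_{\mathbf A}](\mathbf 0,\mathbf 0)\mathbf u\|$ be the pull-back of the product Fubini–Study norm at $([\omega_1],\dots,[\omega_n])\in\prod_i\mathbb P(\mathbb C^{A_i})$. Assume that $D[\boldsymbol\Omega_{\mathbf A}](\mathbf 0,\mathbf 0)$ has full rank $n$, so that $\|\cdot\|_\omega$ is a norm on $\mathbb C^n$. For a system $\mathbf f=(f_1,\dots,f_n)$ of non-zero coefficient (row) vectors $f_i\in\mathbb C^{A_i}$ let $f_iR_i(\mathbf 0,\mathbf y)=(f_{i\mathbf a}e^{\mathbf c\mathbf y})_{\mathbf a=[\mathbf b\,\mathbf c]\in A_i}$. Let $(\mathbf g_t)_{t\in[0,T]}$, $0\le T<\infty$, be a $C^1$ path of such systems, let $$\mathbf Q_{t,\bar{\mathbf y}}(\mathbf X,\mathbf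 y)=\left(\frac{(g_t)_iR_i(\mathbf 0,\bar{\mathbf y})\,\Omega_{A_i}(\mathbf X,\mathbf y)}{\|\omega_i\|\,\|(g_t)_iR_i(\mathbf 0,\bar{\mathbf y})\|}\right)_{1\le i\le n}$$ and let $N(\mathbf Q;\mathbf p)=\mathbf p-D\mathbf Q(\mathbf p)^{-1}\mathbf Q(\mathbf p)$ be Newton iteration. For $c_{**}$ and $\alpha$ given, the *partially renormalized homotopy* from $t_0=0$ and $(\mathbf X_0,\mathbf y_0)$ is the recurrence $$(\mathbf X_{j+1},\mathbf y_{j+1})=(\mathbf 0,\mathbf y_j)+N(\mathbf Q_{t_j,\mathbf y_j};\mathbf X_j,\mathbf 0),\qquad t_{j+1}=\min\bigl(T,\inf\{t>t_j:\ c_{**}\beta_{j+1}(t)\mu_{j+1}(t)>\alpha\}\bigr),$$ $$\beta_j(t)=\|D\mathbf Q_{t,\mathbf y_j}(\mathbf X_j,\mathbf 0)^{-1}\mathbf Q_{t,\mathbf y_j}(\mathbf X_j,\mathbf 0)\|_\omega,\qquad \mu_j(t)=\|D\mathbf Q_{t,\mathbf y_j}(\mathbf X_j,\mathbf 0)^{-1}\|_\omega,$$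 where $\beta_j(t)=\mu_j(t)=\infty$ if $D\mathbf Q_{t,\mathbf y_j}(\mathbf X_j,\mathbf 0)$ is singular, and operator norms are from the Hermitian norm of $\mathbb C^n$ to $\|\cdot\|_\omega$. The *zero path* $(\tilde{\mathbf X}_t,\tilde{\mathbf y}_t)$ is defined for $t\in[t_j,t_{j+1}]$ by $(\tilde{\mathbf X}_t,\tilde{\mathbf y}_t-\mathbf y_{j+1})=\lim_s N^s(\mathbf Q_{t,\mathbf y_{j+1}};\mathbf X_{j+1},\mathbf 0)$, and by the same formula with $j+1$ replaced by $0$ at $t=t_0$. (At a common endpoint the definition with the smaller index is used; part (b) says that both agree.) With $\tilde\mu(t)=\|D\mathbf Q_{t,\tilde{\mathbf y}_t}(\tilde{\mathbf X}_t,\mathbf 0)^{-1}\|_\omega$, its *partially renormalized condition length* is $$\mathscr L_l(0,\tau)=\int_0^{\tau}\left(\left\|\tfrac{\partial}{\partial t}\bigl(\mathbf g_tR(\mathbf 0,\tilde{\mathbf y}_t)\bigr)\right\|_{\mathbf g_tR(\mathbf 0,\tilde{\mathbf y}_t)}+\left\|\tfrac{\partial}{\partial t}(\tilde{\mathbf X}_t,\tilde{\mathbf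 y}_t)\right\|_\omega\right)\tilde\mu(t)\,\mathrm dt ,$$ the first norm being the product Fubini–Study norm in $\prod_i\mathbb P(\mathbb C^{A_i})$. **Theorem.** There are constants $c_{**}\ge1$, $\alpha_*>0$, $u_*>0$ depending only on $\mathbf A$ and the splitting, and for each $0<\alpha\le\alpha_*$ a constant $C$ depending only on $\mathbf A$, the splitting and $\alpha$, with the following properties. Suppose that $c_{**}\beta_0(t_0)\mu_0(t_0)\le\alpha\le\alpha_*$, that $(t_j,\mathbf X_j,\mathbf y_j)_{0\le j\le J}$ is produced by the partially renormalized homotopy, that $\max_k|(\mathbf X_j)_k|\le\frac14$ for $0\le j\le J$, and that $\mathscr L_l(0,t_J)<\infty$. Then: (a) $c_{**}\beta_j(t_j)\mu_j(t_j)\le\alpha$ for all $j\le J$. (b) For $j\le J$ and $t=t_j$, and also for $1\le j\le J$ and $t_{j-1}\le t\le t_j$, the Newton iterates of $\mathbf Q_{t,\mathbf y_j}$ from $(\mathbf X_j,\mathbf 0)$ are well defined and converge to a zero, which is $\mathbf z=(\tilde{\mathbf X}_t,\tilde{\mathbf y}_t-\mathbf y_j)$; the convergence is quadratic in the sense of Smale,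 $\|N^s(\mathbf X_j,\mathbf 0)-\mathbf z\|_\omega\le 2^{1-2^s}\|(\mathbf X_j,\mathbf 0)-\mathbf z\|_\omega$. The path $(\tilde{\mathbf X}_t,\tilde{\mathbf y}_t)$ is continuous on $[0,t_J]$. (c) $\max_{k\le l}|(\tilde{\mathbf X}_t)_k|\le\frac12$ for $0\le t\le t_J$. (d) For $j<J$ and $t_j\le t\le t_{j+1}$, $\tilde\mu(t)<\infty$ and $u_j(t):=\tilde\mu(t)\,\|(\mathbf X_{j+1}-\tilde{\mathbf X}_t,\mathbf y_{j+1}-\tilde{\mathbf y}_t)\|_\omega\le u_*$. (e) If $t_J<T$, then $J\le C\,\mathscr L_l(0,t_J)$. If only $t_j<T$ for all $j<J$ (the last step may have reached $T$), then $J\le 1+C\,\mathscr L_l(0,t_J)$. -/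

import Mathlib

open scoped ENNReal Topology
open Filter MeasureTheory Set

noncomputable section

namespace PartialRenorm

/-! ### Supports, the outer fan and the normal form -/

/-- The real space `ℝ^n = ℝ^l × ℝ^m` with its splitting (`n = l + m`). It carries both the
exponents `a = [b c]` and the directions `ξ` on which exponents act. -/
abbrev RealSplit (l m : ℕ) : Type := (Fin l → ℝ) × (Fin m → ℝ)

/-- The coordinate space `ℂ^l × ℂ^m` of the pairs `(X, y)`. -/
abbrev Coord (l m : ℕ) : Type := (Fin l → ℂ) × (Fin m → ℂ)

/-- A tuple `A = (A_1, …, A_n)` of finite supports in `ℝ^n = ℝ^l × ℝ^m`. -/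
abbrev Supports (l m : ℕ) : Type := Fin (l + m) → Finset (RealSplit l m)

/-- The product `a ξ` of a row vector `a` and a column vector `ξ`. -/
def pairing {l m : ℕ} (a ξ : RealSplit l m) : ℝ :=
  ∑ k, a.1 k * ξ.1 k + ∑ k, a.2 k * ξ.2 k

/-- `S^ξ`: the elements `a` of `S` with `a ξ` maximal. -/
def face {l m : ℕ} (S : Finset (RealSplit l m)) (ξ : RealSplit l m) : Set (RealSplit l m) :=
  {a | a ∈ S ∧ ∀ a' ∈ S, pairing a' ξ ≤ pairing a ξ}

/-- The outer cone `C(B_1, …, B_n)`: all `ξ` with `A_i^ξ = B_i` for every `i`. -/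
def outerCone {l m : ℕ} (A : Supports l m) (B : Fin (l + m) → Set (RealSplit l m)) :
    Set (RealSplit l m) :=
  {ξ | ∀ i, face (A i) ξ = B i}

/-- The outer fan of `A`: the closures of the (non-empty) outer cones `C(B_1, …, B_n)` with
`B_i` a non-empty subset of `A_i`. -/
def outerFan {l m : ℕ} (A : Supports l m) : Set (Set (RealSplit l m)) :=
  {σ | ∃ B : Fin (l + m) → Set (RealSplit l m),
    (∀ i, B i ⊆ (A i : Set (RealSplit l m)) ∧ (B i).Nonempty) ∧
      (outerCone A B).Nonempty ∧ σ = closure (outerCone A B)}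

/-- `Cone(v)`, the half-line of the non-negative multiples of `v`. -/
def halfLine {l m : ℕ} (v : RealSplit l m) : Set (RealSplit l m) :=
  {ξ | ∃ s : ℝ, 0 ≤ s ∧ ξ = s • v}

/-- The canonical basis vectors of the first block. -/
def basisFst {l m : ℕ} (k : Fin l) : RealSplit l m := (Pi.single k 1, 0)

/-- The canonical basis vectors of the second block. -/
def basisSnd {l m : ℕ} (k : Fin m) : RealSplit l m := (0, Pi.single k 1)

/-- `A` is in normal form with splitting `ℝ^n = ℝ^l × ℝ^m`, `l ≥ 1`. -/
structure IsNormalForm {l m : ℕ} (A : Supports l m) : Prop where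
  one_le : 1 ≤ l
  sub_integer : ∀ i, ∀ a ∈ A i, ∀ a' ∈ A i,
    (∀ k, ∃ z : ℤ, a.1 k - a'.1 k = z) ∧ (∀ k, ∃ z : ℤ, a.2 k - a'.2 k = z)
  nonneg : ∀ i, ∀ a ∈ A i, ∀ k, 0 ≤ a.1 k
  exists_zero : ∀ i, ∃ a ∈ A i, a.1 = 0
  sum_zero : ∀ i, ∑ a ∈ (A i).filter (fun a => a.1 = 0), a.2 = 0
  ray_fst : ∀ k : Fin l, halfLine (-basisFst k) ∈ outerFan A
  ray_snd : ∀ k : Fin m, halfLine (-basisSnd k) ∈ outerFan A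
  full_cone : ∃ σ ∈ outerFan A, Submodule.span ℝ σ = ⊤ ∧
    (∀ k : Fin l, -basisFst k ∈ σ) ∧ (∀ k : Fin m, -basisSnd k ∈ σ)

/-! ### The parameterization near toric infinity and its metric -/

/-- `Ω_{A_i}(X, y)`, with coordinates `X^b e^{c y}`, `[b c] ∈ A_i`. For `A` in normal form
every `b` is a vector of non-negative integers, so that the floor changes nothing. -/
def param {l m : ℕ} (A : Supports l m) (i : Fin (l + m)) (p : Coord l m) :
    EuclideanSpace ℂ (A i) :=
  WithLp.toLp 2 fun a =>
    (∏ k, p.1 k ^ ⌊a.1.1 k⌋₊) * Complex.exp (∑ k, (a.1.2 k : ℂ) * p.2 k)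

/-- A representative of `v`, seen as a tangent vector at the point `[p]` of projective space
with the Fubini-Study metric: the component of `v` orthogonal to `p`, divided by `‖p‖`. -/
def projTangent {ι : Type*} [Fintype ι] (p v : EuclideanSpace ℂ ι) : EuclideanSpace ℂ ι :=
  ((‖p‖ : ℂ)⁻¹) • (v - (inner ℂ p v / (‖p‖ : ℂ) ^ 2) • p)

/-- `D[Ω_{A_i}](0,0) u`, the derivative at the origin of the map into projective space. -/
def tangentAtInfinity {l m : ℕ} (A : Supports l m) (u : Coord l m) (i : Fin (l + m)) :
    EuclideanSpace ℂ (A i) :=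
  projTangent (param A i 0) (fderiv ℂ (param A i) 0 u)

/-- `‖u‖_ω`, the pull-back to `ℂ^l × ℂ^m` of the product Fubini-Study norm at the point
`ω = [Ω_A(0,0)]`. -/
def omegaNorm {l m : ℕ} (A : Supports l m) (u : Coord l m) : ℝ :=
  √(∑ i, ‖tangentAtInfinity A u i‖ ^ 2)

/-- Local non-degeneracy: `A` is in normal form, and the normal coordinates are regular at
`ω`, i.e. the `n`-column matrix of `D[Ω_A](0,0)` has full rank. -/
structure LocallyNondegenerate {l m : ℕ} (A : Supports l m) : Prop where
  normalForm : IsNormalForm A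
  regular : Function.Injective (tangentAtInfinity A)

/-! ### Systems, partial renormalization and the local maps at infinity -/

/-- Coefficient vectors of systems with support `A`. -/
abbrev System {l m : ℕ} (A : Supports l m) : Type := ∀ i, EuclideanSpace ℂ (A i)

/-- `f_i R_i(0, y)`: each coefficient `f_{i a}`, `a = [b c]`, is multiplied by `e^{c y}`. -/
def renorm {l m : ℕ} {A : Supports l m} (f : System A) (y : Fin m → ℂ) : System A :=
  fun i => WithLp.toLp 2 fun a => f i a * Complex.exp (∑ k, (a.1.2 k : ℂ) * y k)

/-- The product `f_i v` of a row vector of coefficients and a column vector. -/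
def rowMul {ι : Type*} [Fintype ι] (f v : EuclideanSpace ℂ ι) : ℂ := ∑ a, f a * v a

/-- The local map at infinity `Q` of the system `f`, renormalized at `ybar`: its coordinates
are `q_i Ω_{A_i}(X, y) / (‖ω_i‖ ‖q_i‖)` with `q = f R(0, ybar)` and `ω_i = Ω_{A_i}(0,0)`. -/
def localMap {l m : ℕ} (A : Supports l m) (f : System A) (ybar : Fin m → ℂ)
    (p : Coord l m) : EuclideanSpace ℂ (Fin (l + m)) :=
  WithLp.toLp 2 fun i =>
    rowMul (renorm f ybar i) (param A i p) / ((‖param A i 0‖ : ℂ) * (‖renorm f ybar i‖ : ℂ))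

/-- Newton iteration of a map `Q`. It is meaningful where `DQ` is invertible. -/
def newton {l m : ℕ} (Q : Coord l m → EuclideanSpace ℂ (Fin (l + m))) (p : Coord l m) :
    Coord l m :=
  p - (fderiv ℂ Q p).inverse (Q p)

open Classical in
/-- `‖M⁻¹‖_ω`: the operator norm of `M⁻¹` from `ℂ^n` with the Hermitian norm to
`ℂ^l × ℂ^m` with the norm `‖·‖_ω`; it is infinite when `M` is not invertible. -/
def invNorm {l m : ℕ} (A : Supports l m)
    (M : Coord l m →L[ℂ] EuclideanSpace ℂ (Fin (l + m))) : ℝ≥0∞ :=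
  if M.IsInvertible then
    ⨆ w : EuclideanSpace ℂ (Fin (l + m)), ⨆ _ : ‖w‖ ≤ 1,
      ENNReal.ofReal (omegaNorm A (M.inverse w))
  else ⊤

/-- `‖DQ(X,0)⁻¹‖_ω` for the local map `Q` of `f` renormalized at `ybar`. -/
def mu {l m : ℕ} (A : Supports l m) (f : System A) (ybar : Fin m → ℂ) (X : Fin l → ℂ) :
    ℝ≥0∞ :=
  invNorm A (fderiv ℂ (localMap A f ybar) (X, 0))

open Classical in
/-- `‖DQ(X,0)⁻¹ Q(X,0)‖_ω` for the local map `Q` of `f` renormalized at `ybar`; it is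
infinite when `DQ(X,0)` is not invertible. -/
def beta {l m : ℕ} (A : Supports l m) (f : System A) (ybar : Fin m → ℂ) (X : Fin l → ℂ) :
    ℝ≥0∞ :=
  if (fderiv ℂ (localMap A f ybar) (X, 0)).IsInvertible then
    ENNReal.ofReal (omegaNorm A
      ((fderiv ℂ (localMap A f ybar) (X, 0)).inverse (localMap A f ybar (X, 0))))
  else ⊤

/-! ### The partially renormalized homotopy -/

/-- The first `J` steps `(t_j, X_j, y_j)` of the partially renormalized homotopy for the path
`g` on `[0, T]`, with constants `c` (for `c_**`) and `α`. In `step` the infimum of a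
subset of `[0, T]` together with `T` is `min (T, inf {t > t_j : c β_{j+1}(t) μ_{j+1}(t) > α})`. -/
structure IsHomotopyRun {l m : ℕ} (A : Supports l m) (c α T : ℝ) (g : ℝ → System A) (J : ℕ)
    (t : ℕ → ℝ) (X : ℕ → Fin l → ℂ) (y : ℕ → Fin m → ℂ) : Prop where
  start : t 0 = 0
  iterate : ∀ j < J,
    ((X (j + 1), y (j + 1)) : Coord l m) =
      (0, y j) + newton (localMap A (g (t j)) (y j)) (X j, 0)
  step : ∀ j < J, t (j + 1) =
    sInf (insert T {τ | t j < τ ∧ τ ≤ T ∧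
      ENNReal.ofReal α < ENNReal.ofReal c *
        beta A (g τ) (y (j + 1)) (X (j + 1)) * mu A (g τ) (y (j + 1)) (X (j + 1))})

/-- `z` is the zero of the local map `Q` of `f`, renormalized at `ybar`, associated to the
approximate zero `(X, 0)` in the sense of Smale: the Newton iterates `N^s(Q; X, 0)` are
well defined and converge to `z`, quadratically from the start on. -/
structure IsAssociatedZero {l m : ℕ} (A : Supports l m) (f : System A) (ybar : Fin m → ℂ)
    (X : Fin l → ℂ) (z : Coord l m) : Prop where
  wellDefined : ∀ s : ℕ,
    (fderiv ℂ (localMap A f ybar) ((newton (localMap A f ybar))^[s] (X, 0))).IsInvertible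
  isZero : localMap A f ybar z = 0
  tendsto : Tendsto (fun s : ℕ => (newton (localMap A f ybar))^[s] (X, 0)) atTop (𝓝 z)
  quadratic : ∀ s : ℕ,
    omegaNorm A ((newton (localMap A f ybar))^[s] (X, 0) - z) ≤
      2 * (1 / 2 : ℝ) ^ (2 ^ s) * omegaNorm A ((X, 0) - z)

/-- The path `τ ↦ (X̃_τ, ỹ_τ)` of zeros followed by the homotopy: at time `τ`, take the first
`j` with `τ ≤ t_j` (so `j = 0` at time `t_0`, and `j + 1` on `(t_j, t_{j+1}]`), and the limit of
the Newton iterates of `Q_{τ, y_j}` from `(X_j, 0)`, translated by `(0, y_j)`. -/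
def zeroPath {l m : ℕ} (A : Supports l m) (g : ℝ → System A)
    (t : ℕ → ℝ) (X : ℕ → Fin l → ℂ) (y : ℕ → Fin m → ℂ) (τ : ℝ) : Coord l m :=
  (0, y (sInf {j : ℕ | τ ≤ t j})) +
    limUnder atTop (fun s : ℕ =>
      (newton (localMap A (g τ) (y (sInf {j : ℕ | τ ≤ t j}))))^[s]
        (X (sInf {j : ℕ | τ ≤ t j}), 0))

/-- The speed at time `τ` of the path `[g_τ R(0, y_τ)]` in multiprojective space, for the product
Fubini-Study metric. -/
def renormSpeed {l m : ℕ} (A : Supports l m) (g : ℝ → System A) (y : ℝ → Fin m → ℂ) (τ : ℝ) :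
    ℝ :=
  √(∑ i, ‖projTangent (renorm (g τ) (y τ) i)
    (deriv (fun s => renorm (g s) (y s) i) τ)‖ ^ 2)

/-- The partially renormalized condition length on `[T₁, T₂]` of the path `g` of systems,
along the path `ζ = (X̃, ỹ)` of zeros. -/
def renormLength {l m : ℕ} (A : Supports l m) (g : ℝ → System A) (ζ : ℝ → Coord l m)
    (T₁ T₂ : ℝ) : ℝ≥0∞ :=
  ∫⁻ τ in Icc T₁ T₂,
    (ENNReal.ofReal (renormSpeed A g (fun s => (ζ s).2) τ) +
      ENNReal.ofReal (omegaNorm A (deriv ζ τ))) * mu A (g τ) (ζ τ).2 (ζ τ).1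

end PartialRenorm

end

/-!
Write `κ = 1 / μ` for the least gain `inf {‖DQ u‖ : ‖u‖_ω = 1}` (`leastGain`). It is a real number
also at singular points and is Lipschitz in the operator, so that everything about `μ` becomes a
lower bound for an operator, and `β μ ≤ α` becomes `0 < κ` and `β ≤ α κ` (`IsApprox`).

**Uniformity.** The local maps of all systems have unit coefficient vectors, so on the unit polydisk
their derivatives are bounded by `K` and `K`-Lipschitz, with one constant `K` for the support
(`IsRegularityBound`). Hence `κ ≤ K`, and `β ≤ α κ` is small: all iterates and zeros stay in the
polydisk, near the starting point. Changing the renormalization point translates the local map and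
rescales its equations, by factors in `[1/2, 2]` for small changes. Newton iteration does not see the
rescaling, so the Newton sequences before and after a step are shifts of each other.

**Approximate zeros.** A Kantorovich argument (`exists_zero_of_newtonStep`) gives the quadratically
convergent Newton sequence, and one step improves the bound `α` for `β μ` to `α / 512`
(`IsRegularityBound.isApprox_next`). The zeros form a path that is continuous, and `C^1` inside each
step by the implicit function theorem.

**Condition length.** Along the path of zeros, `κ` decreases at most at the rate `K ^ 3` times the
speed (`IsRegularityBound.ofReal_pathGain_sub_le`). The Fubini-Study speed does not see phases; they
are removed by a horizontal lift of the coefficient path (`exists_phase_enorm_sub_le`). Since the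
condition length is the integral of the speed over `κ`, on a piece of small condition length `κ` at
most halves (`le_two_mul_of_lintegral_le`). This is used twice. A finite condition length prevents
`κ` from tending to zero at the end of a step, so the invariant survives there
(`IsStep.isApprox_right`). And a step of small condition length moves the zero little compared with
`κ`, hence ends with `β μ ≤ α / 2` (`IsStep.isApprox_half`), whereas a step that ends before time `T`
ends because `β μ` is about to exceed `α`; so each such step has condition length at least
`α / (64 K ^ 3)` (`le_lintegral_of_time_lt`), and their number is bounded.
-/

namespace PartialRenorm

/-! ### Newton iteration under a Lipschitz bound on the derivative -/

section Newton

variable {E F : Type*} [NormedAddCommGroup E] [NormedSpace ℂ E]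
  [NormedAddCommGroup F] [NormedSpace ℂ F]

/-- The derivative of `Q` is `K`-Lipschitz on `D`, lengths in the domain being measured by `N`. -/
def DerivLipschitzOn (N : Seminorm ℂ E) (K : ℝ) (Q : E → F) (D : Set E) : Prop :=
  ∀ p ∈ D, ∀ p' ∈ D, ∀ u, ‖fderiv ℂ Q p u - fderiv ℂ Q p' u‖ ≤ K * N (p - p') * N u

/-- One step of Newton iteration, for maps between arbitrary normed spaces; `newton` is the case of
the local maps, definitionally. -/
noncomputable def newtonStep (Q : E → F) (p : E) : E := p - (fderiv ℂ Q p).inverse (Q p)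

theorem isInvertible_of_lowerBound [FiniteDimensional ℂ E] [FiniteDimensional ℂ F]
    {N : Seminorm ℂ E} (hN : ∀ u, N u = 0 → u = 0)
    (hEF : Module.finrank ℂ E = Module.finrank ℂ F) {M : E →L[ℂ] F} {k : ℝ} (hk : 0 < k)
    (hM : ∀ u, k * N u ≤ ‖M u‖) : M.IsInvertible := by
  have hinj : Function.Injective M.toLinearMap := by
    rw [injective_iff_map_eq_zero]
    intro u hu
    have h1 := hM u
    have hu' : M u = 0 := hu
    rw [hu', norm_zero] at h1
    have h2 := apply_nonneg N u
    exact hN u (by nlinarith)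
  refine ⟨(LinearEquiv.ofInjectiveOfFinrankEq M.toLinearMap hinj hEF).toContinuousLinearEquiv, ?_⟩
  ext u
  rfl

theorem apply_inverse_le_of_lowerBound {N : Seminorm ℂ E} {M : E →L[ℂ] F} (hinv : M.IsInvertible)
    {k : ℝ} (hk : 0 < k) (hM : ∀ u, k * N u ≤ ‖M u‖) (w : F) : N (M.inverse w) ≤ ‖w‖ / k := by
  have h := hM (M.inverse w)
  rw [hinv.self_apply_inverse] at h
  rw [le_div_iff₀ hk]
  linarith

/-- Perturbing an operator by at most `δ` lowers its lower bound by at most `δ`. -/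
theorem lowerBound_sub {N : Seminorm ℂ E} {M M' : E →L[ℂ] F} {k δ : ℝ}
    (hM : ∀ u, k * N u ≤ ‖M u‖) (hd : ∀ u, ‖M u - M' u‖ ≤ δ * N u) (u : E) :
    (k - δ) * N u ≤ ‖M' u‖ := by
  have h1 := hM u
  have h2 := hd u
  have h3 := norm_sub_norm_le (M u) (M' u)
  linarith

/-- On a convex set the increment of `Q` is approximated by the derivative at a point `w`, with
relative error `K r`, where `r` bounds the distances to `w`. -/
theorem norm_sub_sub_fderiv_le {N : Seminorm ℂ E} {K : ℝ} {Q : E → F} {D : Set E}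
    (hQ : Differentiable ℂ Q) (hK : 0 ≤ K) (hD : Convex ℝ D) (hL : DerivLipschitzOn N K Q D)
    {p p' w : E} (hp : p ∈ D) (hp' : p' ∈ D) (hw : w ∈ D) {r : ℝ}
    (hr : N (p - w) ≤ r) (hr' : N (p' - w) ≤ r) :
    ‖Q p' - Q p - fderiv ℂ Q w (p' - p)‖ ≤ K * r * N (p' - p) := by
  have hder : ∀ s ∈ Icc (0 : ℝ) 1, HasDerivWithinAt
      (fun s : ℝ => Q (p + (s : ℂ) • (p' - p)) - (s : ℂ) • fderiv ℂ Q w (p' - p))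
      (fderiv ℂ Q (p + (s : ℂ) • (p' - p)) (p' - p) - fderiv ℂ Q w (p' - p)) (Icc 0 1) s := by
    intro s _
    have hs : HasDerivAt (fun s : ℝ => (s : ℂ)) 1 s := Complex.ofRealCLM.hasDerivAt
    have h1 : HasDerivAt (fun s : ℝ => p + (s : ℂ) • (p' - p)) (p' - p) s := by
      simpa using (hs.smul_const (p' - p)).const_add p
    have h2 := ((hQ (p + (s : ℂ) • (p' - p))).hasFDerivAt.restrictScalars ℝ).comp_hasDerivAt s h1
    have h3 : HasDerivAt (fun s : ℝ => (s : ℂ) • fderiv ℂ Q w (p' - p))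
        (fderiv ℂ Q w (p' - p)) s := by
      simpa using hs.smul_const (fderiv ℂ Q w (p' - p))
    exact (h2.sub h3).hasDerivWithinAt
  have hb : ∀ s ∈ Ico (0 : ℝ) 1,
      ‖fderiv ℂ Q (p + (s : ℂ) • (p' - p)) (p' - p) - fderiv ℂ Q w (p' - p)‖
        ≤ K * r * N (p' - p) := by
    intro s hs
    have hmem : p + (s : ℂ) • (p' - p) ∈ D := by
      have := hD.add_smul_sub_mem hp hp' ⟨hs.1, hs.2.le⟩
      simpa using this
    refine (hL _ hmem _ hw _).trans ?_
    have hdist : N (p + (s : ℂ) • (p' - p) - w) ≤ r := by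
      have he : p + (s : ℂ) • (p' - p) - w
          = ((1 - s : ℝ) : ℂ) • (p - w) + (s : ℂ) • (p' - w) := by
        push_cast; module
      rw [he]
      refine (map_add_le_add N _ _).trans ?_
      rw [map_smul_eq_mul, map_smul_eq_mul, Complex.norm_real, Complex.norm_real,
        Real.norm_of_nonneg hs.1, Real.norm_of_nonneg (by linarith [hs.2])]
      nlinarith [hs.1, hs.2]
    have := apply_nonneg N (p' - p)
    gcongr
  have h := norm_image_sub_le_of_norm_deriv_le_segment_01' hder hb
  simpa [sub_right_comm] using h

/-- Close to a point where `DQ` is bounded below, `Q` is expanding. -/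
theorem lowerBound_mul_le_norm_sub {N : Seminorm ℂ E} {K : ℝ} {Q : E → F} {D : Set E}
    (hQ : Differentiable ℂ Q) (hK : 0 ≤ K) (hD : Convex ℝ D) (hL : DerivLipschitzOn N K Q D)
    {p p' w : E} (hp : p ∈ D) (hp' : p' ∈ D) (hw : w ∈ D) {r k : ℝ}
    (hr : N (p - w) ≤ r) (hr' : N (p' - w) ≤ r)
    (hk : ∀ u, k * N u ≤ ‖fderiv ℂ Q w u‖) :
    (k - K * r) * N (p' - p) ≤ ‖Q p' - Q p‖ := by
  have h1 := norm_sub_sub_fderiv_le hQ hK hD hL hp hp' hw hr hr'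
  have h2 := hk (p' - p)
  have h3 := norm_sub_norm_le (fderiv ℂ Q w (p' - p)) (Q p' - Q p)
  rw [norm_sub_rev (fderiv ℂ Q w (p' - p)) (Q p' - Q p)] at h3
  linarith

/-- The Newton correction at `x` is at most twice the distance to a zero. -/
theorem apply_newton_correction_le {N : Seminorm ℂ E} {K : ℝ} {Q : E → F} {D : Set E}
    (hQ : Differentiable ℂ Q) (hK : 0 ≤ K) (hD : Convex ℝ D) (hL : DerivLipschitzOn N K Q D)
    {x z : E} (hx : x ∈ D) (hz : z ∈ D) (hQz : Q z = 0) {k : ℝ} (hk : 0 < k)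
    (hlow : ∀ u, k * N u ≤ ‖fderiv ℂ Q x u‖) (hinv : (fderiv ℂ Q x).IsInvertible)
    (hsmall : K * N (z - x) ≤ k) :
    N ((fderiv ℂ Q x).inverse (Q x)) ≤ 2 * N (z - x) := by
  have h1 := norm_sub_sub_fderiv_le hQ hK hD hL hx hz hx (r := N (z - x)) (by simp) le_rfl
  rw [hQz, zero_sub] at h1
  have h2 := apply_inverse_le_of_lowerBound hinv hk hlow (-Q x - fderiv ℂ Q x (z - x))
  rw [map_sub, map_neg, hinv.inverse_apply_self] at h2
  have h3 : ‖-Q x - fderiv ℂ Q x (z - x)‖ / k ≤ N (z - x) := by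
    rw [div_le_iff₀ hk]
    refine h1.trans ?_
    have := apply_nonneg N (z - x)
    nlinarith
  have h4 : (fderiv ℂ Q x).inverse (Q x)
      = -(-(fderiv ℂ Q x).inverse (Q x) - (z - x)) - (z - x) := by abel
  rw [h4]
  refine (map_sub_le_add N _ _).trans ?_
  rw [map_neg_eq_map]
  linarith

/-- After one Newton step the residual is quadratically small. -/
theorem norm_apply_newtonStep_le {N : Seminorm ℂ E} {K : ℝ} {Q : E → F} {D : Set E}
    (hQ : Differentiable ℂ Q) (hK : 0 ≤ K) (hD : Convex ℝ D) (hL : DerivLipschitzOn N K Q D)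
    {x : E} (hx : x ∈ D) (hx' : newtonStep Q x ∈ D) (hinv : (fderiv ℂ Q x).IsInvertible) :
    ‖Q (newtonStep Q x)‖ ≤ K * N (newtonStep Q x - x) ^ 2 := by
  have h1 := norm_sub_sub_fderiv_le hQ hK hD hL hx hx' hx (r := N (newtonStep Q x - x))
    (by simp) le_rfl
  have h2 : fderiv ℂ Q x (newtonStep Q x - x) = -Q x := by
    simp [newtonStep, hinv.self_apply_inverse]
  rw [h2, sub_neg_eq_add, sub_add_cancel] at h1
  linarith

theorem newtonStep_sub (Q : E → F) (x : E) :
    newtonStep Q x - x = -(fderiv ℂ Q x).inverse (Q x) := by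
  simp [newtonStep]

/-- A Newton step squares the distance to a zero, up to the factor `K / k`. -/
theorem apply_newtonStep_sub_zero_le {N : Seminorm ℂ E} {K : ℝ} {Q : E → F} {D : Set E}
    (hQ : Differentiable ℂ Q) (hK : 0 ≤ K) (hD : Convex ℝ D) (hL : DerivLipschitzOn N K Q D)
    {x z : E} (hx : x ∈ D) (hz : z ∈ D) (hQz : Q z = 0) {k : ℝ} (hk : 0 < k)
    (hlow : ∀ u, k * N u ≤ ‖fderiv ℂ Q x u‖) (hinv : (fderiv ℂ Q x).IsInvertible) :
    N (newtonStep Q x - z) ≤ K / k * N (x - z) ^ 2 := by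
  have h1 := norm_sub_sub_fderiv_le hQ hK hD hL hx hz hx (r := N (z - x)) (by simp) le_rfl
  rw [hQz, zero_sub] at h1
  have h2 := apply_inverse_le_of_lowerBound hinv hk hlow (-Q x - fderiv ℂ Q x (z - x))
  rw [map_sub, map_neg, hinv.inverse_apply_self] at h2
  have h4 : newtonStep Q x - z = -(fderiv ℂ Q x).inverse (Q x) - (z - x) := by
    simp [newtonStep]; abel
  rw [h4, map_sub_rev N x z]
  refine h2.trans ?_
  rw [div_mul_eq_mul_div]
  gcongr
  linarith

/-- Kantorovich-type estimates for the Newton iterates from a point with small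
`β μ` (`μ = 1 / k`): they stay in the domain, `DQ` stays bounded below, and the steps
decrease geometrically. -/
theorem newtonStep_iterate_estimates [FiniteDimensional ℂ E] [FiniteDimensional ℂ F]
    {N : Seminorm ℂ E} (hN : ∀ u, N u = 0 → u = 0)
    (hEF : Module.finrank ℂ E = Module.finrank ℂ F) {K : ℝ} {Q : E → F} {D : Set E}
    (hQ : Differentiable ℂ Q) (hK : 0 ≤ K) (hD : Convex ℝ D) (hL : DerivLipschitzOn N K Q D)
    {x : E} {k β : ℝ} (hk : 0 < k) (hlow : ∀ u, k * N u ≤ ‖fderiv ℂ Q x u‖)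
    (hβ : N ((fderiv ℂ Q x).inverse (Q x)) ≤ β) (hsmall : 16 * K * β ≤ k)
    (hball : ∀ p, N (p - x) ≤ 2 * β → p ∈ D) (s : ℕ) :
    N ((newtonStep Q)^[s] x - x) ≤ 8 / 7 * β * (1 - (1 / 8) ^ s) ∧
    (∀ u, 7 / 8 * k * N u ≤ ‖fderiv ℂ Q ((newtonStep Q)^[s] x) u‖) ∧
    N ((newtonStep Q)^[s + 1] x - (newtonStep Q)^[s] x) ≤ β * (1 / 8) ^ s := by
  have hβ0 : 0 ≤ β := (apply_nonneg N _).trans hβ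
  have hx : x ∈ D := hball x (by simpa using hβ0)
  have hpow : ∀ s : ℕ, 0 ≤ (1 / 8 : ℝ) ^ s := fun s => by positivity
  have key : ∀ p, N (p - x) ≤ 2 * β → ∀ u, 7 / 8 * k * N u ≤ ‖fderiv ℂ Q p u‖ := by
    intro p hp u
    have h := lowerBound_sub (δ := K * (2 * β)) hlow (M' := fderiv ℂ Q p) (fun u => by
      refine (hL _ hx _ (hball p hp) u).trans ?_
      rw [map_sub_rev]
      have := apply_nonneg N u
      gcongr) u
    refine le_trans ?_ h
    have := apply_nonneg N u
    apply mul_le_mul_of_nonneg_right _ this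
    linarith
  induction s with
  | zero =>
    refine ⟨by simp, fun u => ?_, ?_⟩
    · exact key _ (by simpa using hβ0) u
    · simp only [Function.iterate_one, zero_add, Function.iterate_zero, id, pow_zero, mul_one]
      rw [newtonStep_sub, map_neg_eq_map]
      exact hβ
  | succ s ih =>
    obtain ⟨h1, h2, h3⟩ := ih
    have h4 : N ((newtonStep Q)^[s + 1] x - x) ≤ 8 / 7 * β * (1 - (1 / 8) ^ (s + 1)) := by
      have := map_add_le_add N ((newtonStep Q)^[s + 1] x - (newtonStep Q)^[s] x)
        ((newtonStep Q)^[s] x - x)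
      rw [sub_add_sub_cancel] at this
      refine this.trans ((add_le_add h3 h1).trans (le_of_eq ?_))
      rw [pow_succ]; ring
    have hin : ∀ s, N ((newtonStep Q)^[s] x - x) ≤ 8 / 7 * β * (1 - (1 / 8) ^ s) →
        N ((newtonStep Q)^[s] x - x) ≤ 2 * β := by
      intro s h
      nlinarith [hpow s]
    have h5 := key _ (hin _ h4)
    refine ⟨h4, h5, ?_⟩
    have hk' : 0 < 7 / 8 * k := by linarith
    have hinv := isInvertible_of_lowerBound hN hEF hk' h5
    have hinv' := isInvertible_of_lowerBound hN hEF hk' h2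
    have h6 : ‖Q ((newtonStep Q)^[s + 1] x)‖ ≤
        K * N ((newtonStep Q)^[s + 1] x - (newtonStep Q)^[s] x) ^ 2 := by
      have := norm_apply_newtonStep_le hQ hK hD hL (hball _ (hin _ h1))
        (by rw [← Function.iterate_succ_apply' (newtonStep Q)]; exact hball _ (hin _ h4)) hinv'
      rwa [← Function.iterate_succ_apply' (newtonStep Q)] at this
    have h7 := apply_inverse_le_of_lowerBound hinv hk' h5 (Q ((newtonStep Q)^[s + 1] x))
    rw [Function.iterate_succ_apply' _ (s + 1), newtonStep_sub, map_neg_eq_map]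
    refine h7.trans ?_
    rw [div_le_iff₀ hk']
    refine h6.trans ?_
    set b := N ((newtonStep Q)^[s + 1] x - (newtonStep Q)^[s] x)
    have hb0 : 0 ≤ b := apply_nonneg N _
    have h8 : (1 / 8 : ℝ) ^ s ≤ 1 := pow_le_one₀ (by norm_num) (by norm_num)
    have h9 : b ≤ β := h3.trans (by nlinarith)
    have h10 : K * b ^ 2 ≤ K * β * (β * (1 / 8) ^ s) := by
      have : b ^ 2 ≤ β * (β * (1 / 8) ^ s) := by
        rw [sq]; exact mul_le_mul h9 h3 hb0 hβ0
      nlinarith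
    refine h10.trans ?_
    rw [pow_succ]
    have : 0 ≤ β * (1 / 8 : ℝ) ^ s := mul_nonneg hβ0 (hpow s)
    nlinarith

/-- If `β μ` is small, the Newton iterates from `x` converge quadratically, from the first
step on, to a zero at distance at most `2 β`. -/
theorem exists_zero_of_newtonStep [FiniteDimensional ℂ E] [FiniteDimensional ℂ F]
    {N : Seminorm ℂ E} {a : ℝ}
    (hN : ∀ u, N u = 0 → u = 0) (ha : ∀ u, ‖u‖ ≤ a * N u)
    (hNc : Continuous N)
    (hEF : Module.finrank ℂ E = Module.finrank ℂ F) {K : ℝ} {Q : E → F} {D : Set E}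
    (hQ : Differentiable ℂ Q) (hK : 0 ≤ K) (hD : Convex ℝ D) (hL : DerivLipschitzOn N K Q D)
    {x : E} {k β : ℝ} (hk : 0 < k) (hlow : ∀ u, k * N u ≤ ‖fderiv ℂ Q x u‖)
    (hβ : N ((fderiv ℂ Q x).inverse (Q x)) ≤ β) (hsmall : 16 * K * β ≤ k)
    (hball : ∀ p, N (p - x) ≤ 2 * β → p ∈ D) :
    ∃ z, N (z - x) ≤ 2 * β ∧ Q z = 0 ∧
      (∀ s, (fderiv ℂ Q ((newtonStep Q)^[s] x)).IsInvertible) ∧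
      Tendsto (fun s => (newtonStep Q)^[s] x) atTop (𝓝 z) ∧
      ∀ s : ℕ, N ((newtonStep Q)^[s] x - z) ≤ 2 * (1 / 2 : ℝ) ^ (2 ^ s) * N (x - z) := by
  have est := newtonStep_iterate_estimates hN hEF hQ hK hD hL hk hlow hβ hsmall hball
  have hβ0 : 0 ≤ β := (apply_nonneg N _).trans hβ
  have hpow : ∀ s : ℕ, 0 ≤ (1 / 8 : ℝ) ^ s := fun s => by positivity
  have hk' : 0 < 7 / 8 * k := by linarith
  have hbd : ∀ s, N ((newtonStep Q)^[s] x - x) ≤ 8 / 7 * β := fun s =>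
    (est s).1.trans (by nlinarith [hpow s])
  have hmem : ∀ s, (newtonStep Q)^[s] x ∈ D := fun s => hball _ ((hbd s).trans (by linarith))
  have hinv : ∀ s, (fderiv ℂ Q ((newtonStep Q)^[s] x)).IsInvertible := fun s =>
    isInvertible_of_lowerBound hN hEF hk' (est s).2.1
  have : CompleteSpace E := FiniteDimensional.complete ℂ E
  have ha0 : 0 ≤ |a| := abs_nonneg a
  have hcau : CauchySeq (fun s => (newtonStep Q)^[s] x) := by
    refine cauchySeq_of_le_geometric (1 / 8) (|a| * β) (by norm_num) (fun s => ?_)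
    rw [dist_comm, dist_eq_norm]
    refine (ha _).trans ?_
    rw [mul_assoc]
    refine mul_le_mul (le_abs_self a) (est s).2.2 (apply_nonneg N _) ha0
  obtain ⟨z, hz⟩ := cauchySeq_tendsto_of_complete hcau
  have hzx : N (z - x) ≤ 8 / 7 * β :=
    le_of_tendsto ((hNc.tendsto _).comp (hz.sub_const x)) (Eventually.of_forall hbd)
  have hzD : z ∈ D := hball z (hzx.trans (by linarith))
  have hQz : Q z = 0 := by
    have h1 : Tendsto (fun s => Q ((newtonStep Q)^[s + 1] x)) atTop (𝓝 (Q z)) :=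
      (hQ.continuous.tendsto z).comp ((tendsto_add_atTop_iff_nat 1).2 hz)
    have h2 : Tendsto (fun s : ℕ => K * (β * (1 / 8 : ℝ) ^ s) ^ 2) atTop (𝓝 0) := by
      have h := tendsto_pow_atTop_nhds_zero_of_lt_one (r := (1 / 8 : ℝ)) (by norm_num)
        (by norm_num)
      simpa using ((h.const_mul β).pow 2).const_mul K
    refine tendsto_nhds_unique h1 (squeeze_zero_norm (fun s => ?_) h2)
    have h3 := norm_apply_newtonStep_le hQ hK hD hL (hmem s)
      (by rw [← Function.iterate_succ_apply' (newtonStep Q)]; exact hmem _) (hinv s)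
    rw [← Function.iterate_succ_apply' (newtonStep Q)] at h3
    refine h3.trans ?_
    have := apply_nonneg N ((newtonStep Q)^[s + 1] x - (newtonStep Q)^[s] x)
    gcongr
    exact (est s).2.2
  refine ⟨z, hzx.trans (by linarith), hQz, hinv, hz, fun s => ?_⟩
  have hstep : ∀ s, N ((newtonStep Q)^[s + 1] x - z)
      ≤ K / (7 / 8 * k) * N ((newtonStep Q)^[s] x - z) ^ 2 := fun s => by
    rw [Function.iterate_succ_apply']
    exact apply_newtonStep_sub_zero_le hQ hK hD hL (hmem s) hzD hQz hk' (est s).2.1 (hinv s)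
  set e := N (x - z) with he
  have he0 : 0 ≤ e := apply_nonneg N _
  have hae : K / (7 / 8 * k) * e ≤ 1 / 2 := by
    rw [div_mul_eq_mul_div, div_le_iff₀ hk']
    have : e ≤ 8 / 7 * β := by rw [he, map_sub_rev]; exact hzx
    nlinarith
  have hA0 : 0 ≤ K / (7 / 8 * k) := by positivity
  induction s with
  | zero => simp [he]
  | succ s ih =>
    refine (hstep s).trans ?_
    have h0 := apply_nonneg N ((newtonStep Q)^[s] x - z)
    have hsq : N ((newtonStep Q)^[s] x - z) ^ 2 ≤ (2 * (1 / 2 : ℝ) ^ (2 ^ s) * e) ^ 2 := by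
      gcongr
    have h1 : (1 / 2 : ℝ) ^ (2 ^ (s + 1)) = ((1 / 2 : ℝ) ^ (2 ^ s)) ^ 2 := by
      rw [pow_succ 2 s, pow_mul]
    rw [h1]
    set q := (1 / 2 : ℝ) ^ (2 ^ s)
    calc K / (7 / 8 * k) * N ((newtonStep Q)^[s] x - z) ^ 2
        ≤ K / (7 / 8 * k) * (2 * q * e) ^ 2 := by gcongr
      _ = (K / (7 / 8 * k) * e) * (4 * q ^ 2 * e) := by ring
      _ ≤ 1 / 2 * (4 * q ^ 2 * e) := by gcongr
      _ = 2 * q ^ 2 * e := by ring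

end Newton

section

variable {l m : ℕ}

/-! ### The norm at toric infinity and the least gain of an operator -/

theorem finrank_coord (l m : ℕ) :
    Module.finrank ℂ (Coord l m) = Module.finrank ℂ (EuclideanSpace ℂ (Fin (l + m))) := by
  simp [Coord]

/-- `projTangent` with fixed base point, as a linear map. -/
noncomputable def projTangentLinear {ι : Type*} [Fintype ι] (p : EuclideanSpace ℂ ι) :
    EuclideanSpace ℂ ι →ₗ[ℂ] EuclideanSpace ℂ ι where
  toFun := projTangent p
  map_add' v w := by
    simp only [projTangent, inner_add_right, add_div, add_smul, ← smul_add]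
    congr 1; abel
  map_smul' r v := by
    simp only [projTangent, inner_smul_right, RingHom.id_apply, mul_div_assoc, mul_smul]
    rw [← smul_sub, smul_comm]

/-- `D[Ω_A](0,0)` as a linear map into the product of the tangent spaces. -/
noncomputable def omegaLinear (A : Supports l m) :
    Coord l m →ₗ[ℂ] PiLp 2 (fun i => EuclideanSpace ℂ (A i)) where
  toFun u := WithLp.toLp 2 fun i => projTangentLinear (param A i 0) (fderiv ℂ (param A i) 0 u)
  map_add' u v := by ext; simp
  map_smul' r u := by ext; simp

/-- `‖·‖_ω` as a seminorm. -/
noncomputable def omegaSeminorm (A : Supports l m) : Seminorm ℂ (Coord l m) :=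
  (normSeminorm ℂ _).comp (omegaLinear A)

theorem omegaSeminorm_eq_norm (A : Supports l m) (u : Coord l m) :
    omegaSeminorm A u = ‖omegaLinear A u‖ := rfl

theorem omegaNorm_eq (A : Supports l m) (u : Coord l m) :
    omegaNorm A u = omegaSeminorm A u := by
  rw [omegaSeminorm_eq_norm, PiLp.norm_eq_of_L2]
  rfl

theorem continuous_omegaSeminorm (A : Supports l m) : Continuous (omegaSeminorm A) :=
  continuous_norm.comp (LinearMap.continuous_of_finiteDimensional (omegaLinear A))

theorem exists_omegaSeminorm_le (A : Supports l m) :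
    ∃ b : ℝ, 0 < b ∧ ∀ u, omegaSeminorm A u ≤ b * ‖u‖ := by
  refine ⟨‖(omegaLinear A).toContinuousLinearMap‖ + 1, by positivity, fun u => ?_⟩
  have h := (omegaLinear A).toContinuousLinearMap.le_opNorm u
  have h' := norm_nonneg u
  rw [omegaSeminorm_eq_norm]
  change ‖(omegaLinear A).toContinuousLinearMap u‖ ≤ _
  linarith

namespace LocallyNondegenerate

variable {A : Supports l m} (hA : LocallyNondegenerate A)

include hA

theorem omegaLinear_injective : Function.Injective (omegaLinear A) := by
  intro u v h
  exact hA.regular (congrArg (fun w i => w i) h)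

theorem omegaSeminorm_eq_zero (u : Coord l m) (h : omegaSeminorm A u = 0) : u = 0 := by
  rw [omegaSeminorm_eq_norm, norm_eq_zero] at h
  exact hA.omegaLinear_injective (by rw [h, map_zero])

theorem exists_norm_le : ∃ a : ℝ, 0 < a ∧ ∀ u, ‖u‖ ≤ a * omegaSeminorm A u := by
  obtain ⟨K, hK0, hK⟩ := LinearMap.exists_antilipschitzWith (omegaLinear A)
    (LinearMap.ker_eq_bot.2 hA.omegaLinear_injective)
  refine ⟨K, hK0, fun u => ?_⟩
  have h := hK.le_mul_dist u 0
  rwa [dist_zero_right, map_zero, dist_zero_right] at h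

theorem exists_omegaSeminorm_eq_one : ∃ u, omegaSeminorm A u = 1 := by
  have hl := hA.normalForm.one_le
  have hne : omegaSeminorm A ((Pi.single ⟨0, hl⟩ 1, 0) : Coord l m) ≠ 0 := by
    intro h
    have h1 := congrArg (fun u : Coord l m => u.1 ⟨0, hl⟩) (hA.omegaSeminorm_eq_zero _ h)
    simp at h1
  set u : Coord l m := (Pi.single ⟨0, hl⟩ 1, 0)
  have hpos : 0 < omegaSeminorm A u := lt_of_le_of_ne (apply_nonneg _ _) (Ne.symm hne)
  refine ⟨(((omegaSeminorm A u)⁻¹ : ℝ) : ℂ) • u, ?_⟩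
  rw [map_smul_eq_mul, Complex.norm_real, Real.norm_of_nonneg (by positivity)]
  exact inv_mul_cancel₀ hne

end LocallyNondegenerate

/-- The least gain `inf {‖M u‖ : ‖u‖_ω = 1}`. Its inverse is `‖M⁻¹‖_ω`, and, unlike the latter,
it is a real number that depends on `M` in a Lipschitz way, singular operators included. -/
noncomputable def leastGain (A : Supports l m)
    (M : Coord l m →L[ℂ] EuclideanSpace ℂ (Fin (l + m))) : ℝ :=
  sInf ((fun u => ‖M u‖) '' {u | omegaSeminorm A u = 1})

theorem leastGain_nonneg (A : Supports l m)
    (M : Coord l m →L[ℂ] EuclideanSpace ℂ (Fin (l + m))) : 0 ≤ leastGain A M :=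
  Real.sInf_nonneg (by rintro _ ⟨u, _, rfl⟩; exact norm_nonneg _)

theorem leastGain_mul_le (A : Supports l m)
    (M : Coord l m →L[ℂ] EuclideanSpace ℂ (Fin (l + m))) (u : Coord l m) :
    leastGain A M * omegaSeminorm A u ≤ ‖M u‖ := by
  rcases (apply_nonneg (omegaSeminorm A) u).eq_or_lt with h | h
  · rw [← h, mul_zero]; exact norm_nonneg _
  · have h1 : leastGain A M ≤ ‖M ((((omegaSeminorm A u)⁻¹ : ℝ) : ℂ) • u)‖ := by
      refine csInf_le ⟨0, ?_⟩ ⟨_, ?_, rfl⟩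
      · rintro _ ⟨v, _, rfl⟩; exact norm_nonneg _
      · change omegaSeminorm A _ = 1
        rw [map_smul_eq_mul, Complex.norm_real, Real.norm_of_nonneg (by positivity)]
        exact inv_mul_cancel₀ h.ne'
    rw [map_smul, norm_smul, Complex.norm_real, Real.norm_of_nonneg (by positivity),
      inv_mul_eq_div, le_div_iff₀ h] at h1
    exact h1

namespace LocallyNondegenerate

variable {A : Supports l m} (hA : LocallyNondegenerate A)
  {M M' : Coord l m →L[ℂ] EuclideanSpace ℂ (Fin (l + m))}

include hA

theorem le_leastGain {k : ℝ} (hk : ∀ u, k * omegaSeminorm A u ≤ ‖M u‖) : k ≤ leastGain A M := by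
  obtain ⟨u, hu⟩ := hA.exists_omegaSeminorm_eq_one
  refine le_csInf ⟨_, u, hu, rfl⟩ ?_
  rintro _ ⟨v, hv, rfl⟩
  have h := hk v
  rwa [show omegaSeminorm A v = 1 from hv, mul_one] at h

theorem leastGain_le {k : ℝ} (hk : ∀ u, ‖M u‖ ≤ k * omegaSeminorm A u) : leastGain A M ≤ k := by
  obtain ⟨u, hu⟩ := hA.exists_omegaSeminorm_eq_one
  have h1 := hk u
  have h2 := leastGain_mul_le A M u
  rw [hu, mul_one] at h1 h2
  linarith

theorem leastGain_sub_le {δ : ℝ} (hd : ∀ u, ‖M u - M' u‖ ≤ δ * omegaSeminorm A u) :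
    leastGain A M - δ ≤ leastGain A M' :=
  hA.le_leastGain (lowerBound_sub (leastGain_mul_le A M) hd)

theorem isInvertible_of_leastGain_pos (h : 0 < leastGain A M) : M.IsInvertible :=
  isInvertible_of_lowerBound hA.omegaSeminorm_eq_zero (finrank_coord l m) h
    (leastGain_mul_le A M)

theorem leastGain_pos_of_isInvertible (h : M.IsInvertible) : 0 < leastGain A M := by
  obtain ⟨b, hb0, hb⟩ := exists_omegaSeminorm_le A
  have hpos : 0 < b * (‖M.inverse‖ + 1) := by positivity
  refine lt_of_lt_of_le (inv_pos.2 hpos) (hA.le_leastGain fun u => ?_)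
  rw [inv_mul_eq_div, div_le_iff₀ hpos]
  have h1 := hb (M.inverse (M u))
  rw [h.inverse_apply_self] at h1
  have h2 := M.inverse.le_opNorm (M u)
  rw [h.inverse_apply_self] at h2
  have := norm_nonneg (M u)
  nlinarith

theorem invNorm_eq (M : Coord l m →L[ℂ] EuclideanSpace ℂ (Fin (l + m))) :
    invNorm A M = (ENNReal.ofReal (leastGain A M))⁻¹ := by
  rcases (leastGain_nonneg A M).eq_or_lt with h0 | hpos
  · rw [← h0, ENNReal.ofReal_zero, ENNReal.inv_zero, invNorm, if_neg]
    intro h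
    exact (hA.leastGain_pos_of_isInvertible h).ne h0
  · have hinv := hA.isInvertible_of_leastGain_pos hpos
    rw [invNorm, if_pos hinv, ← ENNReal.ofReal_inv_of_pos hpos]
    apply le_antisymm
    · refine iSup₂_le fun w hw => ENNReal.ofReal_le_ofReal ?_
      rw [omegaNorm_eq]
      refine (apply_inverse_le_of_lowerBound hinv hpos (leastGain_mul_le A M) w).trans ?_
      rw [div_eq_mul_inv]
      have : 0 ≤ (leastGain A M)⁻¹ := by positivity
      nlinarith
    · set S := ⨆ w : EuclideanSpace ℂ (Fin (l + m)), ⨆ _ : ‖w‖ ≤ 1,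
        ENNReal.ofReal (omegaNorm A (M.inverse w)) with hS
      rcases eq_or_ne S ⊤ with hT | hT
      · rw [hT]; exact le_top
      have hle : ∀ w : EuclideanSpace ℂ (Fin (l + m)), ‖w‖ ≤ 1 →
          omegaSeminorm A (M.inverse w) ≤ S.toReal := by
        intro w hw
        rw [← omegaNorm_eq, ← ENNReal.ofReal_le_iff_le_toReal hT]
        exact le_iSup₂ (f := fun (w : EuclideanSpace ℂ (Fin (l + m))) (_ : ‖w‖ ≤ 1) =>
          ENNReal.ofReal (omegaNorm A (M.inverse w))) w hw
      have hle' : ∀ u, omegaSeminorm A u ≤ S.toReal * ‖M u‖ := by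
        intro u
        rcases eq_or_ne (M u) 0 with h0 | h0
        · have : u = 0 := by rw [← hinv.inverse_apply_self u, h0, map_zero]
          simp [this]
        · have hn : 0 < ‖M u‖ := norm_pos_iff.2 h0
          have h1 := hle (((‖M u‖⁻¹ : ℝ) : ℂ) • M u) (by
            rw [norm_smul, Complex.norm_real, Real.norm_of_nonneg (by positivity),
              inv_mul_cancel₀ hn.ne'])
          rwa [map_smul, hinv.inverse_apply_self, map_smul_eq_mul, Complex.norm_real,
            Real.norm_of_nonneg (by positivity), inv_mul_eq_div, div_le_iff₀ hn] at h1
      have hS0 : 0 < S.toReal := by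
        obtain ⟨u, hu⟩ := hA.exists_omegaSeminorm_eq_one
        have h1 := hle' u
        rw [hu] at h1
        by_contra hneg
        have := norm_nonneg (M u)
        nlinarith
      rw [ENNReal.ofReal_le_iff_le_toReal hT]
      have h2 : (S.toReal)⁻¹ ≤ leastGain A M := hA.le_leastGain fun u => by
        rw [inv_mul_eq_div, div_le_iff₀ hS0, mul_comm]
        exact hle' u
      exact inv_le_of_inv_le₀ hS0 h2

end LocallyNondegenerate

/-- `β(X) μ(X) ≤ α` for the local map of `f` renormalized at `ybar`, expressed with the
least gain `1 / μ(X)`. -/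
structure IsApprox (A : Supports l m) (α : ℝ) (f : System A) (ybar : Fin m → ℂ)
    (X : Fin l → ℂ) : Prop where
  pos : 0 < leastGain A (fderiv ℂ (localMap A f ybar) (X, 0))
  le : omegaSeminorm A
      ((fderiv ℂ (localMap A f ybar) (X, 0)).inverse (localMap A f ybar (X, 0))) ≤
    α * leastGain A (fderiv ℂ (localMap A f ybar) (X, 0))

theorem LocallyNondegenerate.beta_mul_mu_le_iff {A : Supports l m} (hA : LocallyNondegenerate A)
    {α : ℝ} (hα : 0 < α) (f : System A) (ybar : Fin m → ℂ) (X : Fin l → ℂ) :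
    ENNReal.ofReal 1 * beta A f ybar X * mu A f ybar X ≤ ENNReal.ofReal α ↔
      IsApprox A α f ybar X := by
  rw [ENNReal.ofReal_one, one_mul]
  have hmu : mu A f ybar X = _ := hA.invNorm_eq (fderiv ℂ (localMap A f ybar) (X, 0))
  rcases (leastGain_nonneg A (fderiv ℂ (localMap A f ybar) (X, 0))).eq_or_lt with h0 | hpos
  · have hni : ¬ (fderiv ℂ (localMap A f ybar) (X, 0)).IsInvertible := fun h =>
      (hA.leastGain_pos_of_isInvertible h).ne h0
    rw [hmu, beta, if_neg hni, ← h0]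
    simp only [ENNReal.ofReal_zero, ENNReal.inv_zero, ENNReal.top_mul_top, top_le_iff,
      ENNReal.ofReal_ne_top, false_iff]
    exact fun h => h.pos.ne h0
  · rw [hmu, beta, if_pos (hA.isInvertible_of_leastGain_pos hpos), ← div_eq_mul_inv,
      ENNReal.div_le_iff (by simpa using hpos) ENNReal.ofReal_ne_top,
      ← ENNReal.ofReal_mul hα.le,
      ENNReal.ofReal_le_ofReal_iff (mul_nonneg hα.le hpos.le), omegaNorm_eq]
    exact ⟨fun h => ⟨hpos, h⟩, fun h => h.le⟩

/-! ### The local maps and their renormalization -/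

/-- The polynomial-exponential map with coefficients `h`, normalized by `‖ω_i‖` only. It is
linear in `h`; the local maps are the case of unit coefficient vectors. -/
noncomputable def model (A : Supports l m) (h : System A) (p : Coord l m) :
    EuclideanSpace ℂ (Fin (l + m)) :=
  WithLp.toLp 2 fun i => rowMul (h i) (param A i p) / (‖param A i 0‖ : ℂ)

/-- Each coefficient vector scaled to norm one. -/
noncomputable def unitSystem {A : Supports l m} (f : System A) : System A :=
  fun i => ((‖f i‖ : ℂ)⁻¹) • f i

/-- The `i`-th equation multiplied by `s i`. -/
noncomputable def scaleSystem {A : Supports l m} (s : Fin (l + m) → ℂ) (f : System A) :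
    System A := fun i => s i • f i

/-- Multiplication of the `i`-th coordinate by `s i`. -/
noncomputable def diagScale {n : ℕ} (s : Fin n → ℂ) (hs : ∀ i, s i ≠ 0) :
    EuclideanSpace ℂ (Fin n) ≃L[ℂ] EuclideanSpace ℂ (Fin n) :=
  LinearEquiv.toContinuousLinearEquiv
    { toFun := fun w => WithLp.toLp 2 fun i => s i * w i
      map_add' := fun v w => by ext i; simp [mul_add]
      map_smul' := fun r w => by ext i; simp [mul_left_comm]
      invFun := fun w => WithLp.toLp 2 fun i => (s i)⁻¹ * w i
      left_inv := fun w => by ext i; simp [hs i]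
      right_inv := fun w => by ext i; simp [hs i] }

@[simp] theorem diagScale_apply {n : ℕ} (s : Fin n → ℂ) (hs : ∀ i, s i ≠ 0)
    (w : EuclideanSpace ℂ (Fin n)) (i : Fin n) : diagScale s hs w i = s i * w i := rfl

theorem mul_norm_le_norm_diagScale {n : ℕ} (s : Fin n → ℂ) (hs : ∀ i, s i ≠ 0) {c : ℝ}
    (hc : 0 ≤ c) (h : ∀ i, c ≤ ‖s i‖) (w : EuclideanSpace ℂ (Fin n)) :
    c * ‖w‖ ≤ ‖diagScale s hs w‖ := by
  rw [EuclideanSpace.norm_eq, EuclideanSpace.norm_eq]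
  apply Real.le_sqrt_of_sq_le
  rw [mul_pow, Real.sq_sqrt (by positivity), Finset.mul_sum]
  refine Finset.sum_le_sum fun i _ => ?_
  rw [diagScale_apply, norm_mul, mul_pow]
  have := h i
  gcongr

theorem norm_diagScale_le {n : ℕ} (s : Fin n → ℂ) (hs : ∀ i, s i ≠ 0) {c : ℝ}
    (hc : 0 ≤ c) (h : ∀ i, ‖s i‖ ≤ c) (w : EuclideanSpace ℂ (Fin n)) :
    ‖diagScale s hs w‖ ≤ c * ‖w‖ := by
  rw [EuclideanSpace.norm_eq, EuclideanSpace.norm_eq]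
  apply Real.sqrt_le_iff.2 ⟨by positivity, ?_⟩
  rw [mul_pow, Real.sq_sqrt (by positivity), Finset.mul_sum]
  refine Finset.sum_le_sum fun i _ => ?_
  rw [diagScale_apply, norm_mul, mul_pow]
  have := h i
  gcongr

theorem model_scaleSystem {A : Supports l m} (s : Fin (l + m) → ℂ) (hs : ∀ i, s i ≠ 0)
    (h : System A) (p : Coord l m) :
    model A (scaleSystem s h) p = diagScale s hs (model A h p) := by
  ext i
  simp [model, scaleSystem, rowMul, Finset.mul_sum, mul_assoc, mul_div_assoc, Finset.sum_div]

theorem localMap_eq_model (A : Supports l m) (f : System A) (ybar : Fin m → ℂ) (p : Coord l m) :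
    localMap A f ybar p = model A (unitSystem (renorm f ybar)) p := by
  ext i
  simp only [localMap, model, unitSystem, rowMul, PiLp.smul_apply, smul_eq_mul, mul_assoc,
    ← Finset.mul_sum]
  rw [inv_mul_eq_div, div_div, mul_comm (‖param A i 0‖ : ℂ)]

theorem model_renorm (A : Supports l m) (f : System A) (v : Fin m → ℂ) (p : Coord l m) :
    model A (renorm f v) p = model A f (p + (0, v)) := by
  ext i
  simp only [model, rowMul, renorm, param]
  congr 1
  refine Finset.sum_congr rfl fun a _ => ?_
  simp only [Prod.fst_add, Prod.snd_add, Pi.add_apply, Pi.zero_apply, add_zero, mul_add,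
    Finset.sum_add_distrib, Complex.exp_add]
  ring

theorem renorm_add {A : Supports l m} (f : System A) (v w : Fin m → ℂ) :
    renorm f (v + w) = renorm (renorm f v) w := by
  funext i
  ext a
  simp [renorm, mul_add, Finset.sum_add_distrib, Complex.exp_add, mul_assoc]

theorem renorm_ne_zero {A : Supports l m} {f : System A} (hf : ∀ i, f i ≠ 0) (v : Fin m → ℂ)
    (i : Fin (l + m)) : renorm f v i ≠ 0 := by
  intro h
  apply hf i
  ext a
  have h1 := congrArg (fun w : EuclideanSpace ℂ (A i) => w a) h
  simpa [renorm, Complex.exp_ne_zero] using h1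

theorem norm_unitSystem_le {A : Supports l m} (f : System A) : ‖unitSystem f‖ ≤ 1 := by
  refine (pi_norm_le_iff_of_nonneg zero_le_one).2 fun i => ?_
  rw [unitSystem, norm_smul, norm_inv, Complex.norm_real, norm_norm]
  exact inv_mul_le_one

/-- Renormalizing at a point close to the origin at most doubles the norms of the coefficient
vectors, because `|e^{c v}| ≤ e^{R ‖v‖}` for all exponents `c`. -/
theorem exists_norm_renorm_le (A : Supports l m) : ∃ δ : ℝ, 0 < δ ∧
    ∀ (f : System A) (v : Fin m → ℂ), ‖v‖ ≤ δ → ∀ i, ‖renorm f v i‖ ≤ 2 * ‖f i‖ := by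
  set R : ℝ := ∑ i, ∑ a : A i, ∑ k, |a.1.2 k| with hR
  have hR0 : 0 ≤ R := by positivity
  refine ⟨Real.log 2 / (R + 1), div_pos (Real.log_pos one_lt_two) (by linarith),
    fun f v hv i => ?_⟩
  have hexp : ∀ a : A i, ‖Complex.exp (∑ k, (a.1.2 k : ℂ) * v k)‖ ≤ 2 := by
    intro a
    have h1 : ‖∑ k, (a.1.2 k : ℂ) * v k‖ ≤ R * ‖v‖ := by
      calc ‖∑ k, (a.1.2 k : ℂ) * v k‖ ≤ ∑ k, |a.1.2 k| * ‖v‖ := by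
            refine (norm_sum_le _ _).trans (Finset.sum_le_sum fun k _ => ?_)
            rw [norm_mul, Complex.norm_real, Real.norm_eq_abs]
            have := norm_le_pi_norm v k
            gcongr
        _ = (∑ k, |a.1.2 k|) * ‖v‖ := by rw [Finset.sum_mul]
        _ ≤ R * ‖v‖ := by
            gcongr
            calc ∑ k, |a.1.2 k| ≤ ∑ a : A i, ∑ k, |a.1.2 k| :=
                  Finset.single_le_sum (f := fun a : A i => ∑ k, |a.1.2 k|)
                    (fun _ _ => by positivity) (Finset.mem_univ a)
              _ ≤ R := Finset.single_le_sum (f := fun i => ∑ a : A i, ∑ k, |a.1.2 k|)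
                    (fun _ _ => by positivity) (Finset.mem_univ i)
    rw [Complex.norm_exp, ← Real.exp_log (show (0 : ℝ) < 2 by norm_num)]
    apply Real.exp_le_exp.2
    refine (Complex.re_le_norm _).trans (h1.trans ?_)
    have h2 : (R + 1) * ‖v‖ ≤ Real.log 2 := by
      rw [le_div_iff₀ (by linarith)] at hv
      linarith
    have := norm_nonneg v
    linarith
  rw [EuclideanSpace.norm_eq, EuclideanSpace.norm_eq]
  apply Real.sqrt_le_iff.2 ⟨by positivity, ?_⟩
  rw [mul_pow, Real.sq_sqrt (by positivity), Finset.mul_sum]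
  refine Finset.sum_le_sum fun a _ => ?_
  simp only [renorm]
  rw [norm_mul, mul_pow, mul_comm]
  have := hexp a
  gcongr

theorem localMap_apply (A : Supports l m) (f : System A) (ybar : Fin m → ℂ) (p : Coord l m)
    (i : Fin (l + m)) :
    localMap A f ybar p i = model A (renorm f ybar) p i / (‖renorm f ybar i‖ : ℂ) := by
  simp [localMap, model, div_div]

/-- Changing the renormalization point translates the local map and rescales its equations;
for a small change the scaling factors lie in `[1/2, 2]`. -/
theorem exists_localMap_add (A : Supports l m) : ∃ δ : ℝ, 0 < δ ∧
    ∀ (f : System A), (∀ i, f i ≠ 0) → ∀ ybar v : Fin m → ℂ, ‖v‖ ≤ δ →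
    ∃ S : EuclideanSpace ℂ (Fin (l + m)) ≃L[ℂ] EuclideanSpace ℂ (Fin (l + m)),
      (∀ p, localMap A f (ybar + v) p = S (localMap A f ybar (p + (0, v)))) ∧
      (∀ w, 1 / 2 * ‖w‖ ≤ ‖S w‖) ∧ ∀ w, ‖S w‖ ≤ 2 * ‖w‖ := by
  obtain ⟨δ, hδ, hb⟩ := exists_norm_renorm_le A
  refine ⟨δ, hδ, fun f hf ybar v hv => ?_⟩
  have h0 : ∀ i, 0 < ‖renorm f ybar i‖ := fun i => norm_pos_iff.2 (renorm_ne_zero hf _ i)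
  have h1 : ∀ i, 0 < ‖renorm f (ybar + v) i‖ := fun i => norm_pos_iff.2 (renorm_ne_zero hf _ i)
  have hup : ∀ i, ‖renorm f (ybar + v) i‖ ≤ 2 * ‖renorm f ybar i‖ := fun i => by
    rw [renorm_add]; exact hb _ v hv i
  have hlo : ∀ i, ‖renorm f ybar i‖ ≤ 2 * ‖renorm f (ybar + v) i‖ := fun i => by
    have h := hb (renorm f (ybar + v)) (-v) (by rwa [norm_neg]) i
    rwa [← renorm_add, add_neg_cancel_right] at h
  set s : Fin (l + m) → ℂ := fun i =>
    ((‖renorm f ybar i‖ / ‖renorm f (ybar + v) i‖ : ℝ) : ℂ) with hs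
  have hnorm : ∀ i, ‖s i‖ = ‖renorm f ybar i‖ / ‖renorm f (ybar + v) i‖ := fun i => by
    rw [hs, Complex.norm_real, Real.norm_of_nonneg (by positivity)]
  have hs0 : ∀ i, s i ≠ 0 := fun i => by
    rw [← norm_pos_iff, hnorm]; exact div_pos (h0 i) (h1 i)
  refine ⟨diagScale s hs0, fun p => ?_, ?_, ?_⟩
  · ext i
    have h0' : (‖renorm f ybar i‖ : ℂ) ≠ 0 := by exact_mod_cast (h0 i).ne'
    rw [diagScale_apply, localMap_apply, localMap_apply, renorm_add f ybar v, model_renorm,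
      ← renorm_add f ybar v, hs]
    push_cast
    field_simp
  · refine mul_norm_le_norm_diagScale s hs0 (by norm_num) fun i => ?_
    rw [hnorm, le_div_iff₀ (h1 i)]
    linarith [hup i]
  · refine norm_diagScale_le s hs0 (by norm_num) fun i => ?_
    rw [hnorm, div_le_iff₀ (h1 i)]
    exact hlo i

/-! ### Smoothness and uniform bounds -/

theorem contDiff_param (A : Supports l m) (i : Fin (l + m)) {n : WithTop ℕ∞} :
    ContDiff ℂ n (param A i) := by
  refine (contDiff_piLp 2).2 fun a => ?_
  simp only [param]
  fun_prop

theorem contDiff_model (A : Supports l m) {n : WithTop ℕ∞} :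
    ContDiff ℂ n (fun hp : System A × Coord l m => model A hp.1 hp.2) := by
  refine (contDiff_piLp 2).2 fun i => ?_
  simp only [model, rowMul]
  refine ContDiff.div_const (ContDiff.sum fun a _ => ?_) _
  have h1 : ContDiff ℂ n (fun hp : System A × Coord l m => hp.1 i a) :=
    (contDiff_piLp 2).1 ((contDiff_pi.1 contDiff_fst) i) a
  have h2 : ContDiff ℂ n (fun hp : System A × Coord l m => param A i hp.2 a) :=
    (contDiff_piLp 2).1 ((contDiff_param A i).comp contDiff_snd) a
  exact h1.mul h2

theorem differentiable_model (A : Supports l m) (h : System A) : Differentiable ℂ (model A h) :=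
  ((contDiff_model A (n := 1)).comp (contDiff_const.prodMk contDiff_id)).differentiable one_ne_zero

theorem contDiff_fderiv_uncurried {H E F : Type*} [NormedAddCommGroup H] [NormedSpace ℂ H]
    [NormedAddCommGroup E] [NormedSpace ℂ E] [NormedAddCommGroup F] [NormedSpace ℂ F]
    {n : WithTop ℕ∞} {f : H → E → F} (hf : ContDiff ℂ (n + 1) (fun x : H × E => f x.1 x.2)) :
    ContDiff ℂ n (fun x : H × E => fderiv ℂ (f x.1) x.2) := by
  have h : ContDiff ℂ (n + 1) (Function.uncurry fun (x : H × E) (q : E) => f x.1 q) :=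
    hf.comp ((contDiff_fst.comp contDiff_fst).prodMk contDiff_snd)
  exact ContDiff.fderiv h contDiff_snd le_rfl

theorem contDiff_fderiv_model (A : Supports l m) {n : WithTop ℕ∞} :
    ContDiff ℂ n (fun hp : System A × Coord l m => fderiv ℂ (model A hp.1) hp.2) :=
  contDiff_fderiv_uncurried (f := model A) (contDiff_model A)

/-- On unit coefficient balls and the unit polydisk, the derivative of the model map is bounded
and Lipschitz, in the coefficients and in the point. -/
theorem exists_fderiv_model_bound (A : Supports l m) : ∃ K : ℝ, 0 < K ∧
    (∀ (h : System A) (p : Coord l m), ‖h‖ ≤ 1 → ‖p‖ ≤ 1 → ‖fderiv ℂ (model A h) p‖ ≤ K) ∧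
    ∀ (h h' : System A) (p p' : Coord l m), ‖h‖ ≤ 1 → ‖h'‖ ≤ 1 → ‖p‖ ≤ 1 → ‖p'‖ ≤ 1 →
      ‖fderiv ℂ (model A h) p - fderiv ℂ (model A h') p'‖ ≤ K * (‖h - h'‖ + ‖p - p'‖) := by
  have hcd := contDiff_fderiv_model A (n := 1)
  have hcpt : IsCompact (Metric.closedBall (0 : System A × Coord l m) 1) :=
    isCompact_closedBall _ _
  obtain ⟨K1, hK1⟩ := hcpt.exists_bound_of_continuousOn hcd.continuous.continuousOn
  obtain ⟨K2, hK2⟩ := LocallyLipschitzOn.exists_lipschitzOnWith_of_compact hcpt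
    (hcd.locallyLipschitz.locallyLipschitzOn)
  have hmem : ∀ (h : System A) (p : Coord l m), ‖h‖ ≤ 1 → ‖p‖ ≤ 1 →
      (h, p) ∈ Metric.closedBall (0 : System A × Coord l m) 1 := fun h p hh hp => by
    rw [mem_closedBall_zero_iff, Prod.norm_mk]
    exact max_le hh hp
  refine ⟨|K1| + K2 + 1, by positivity, fun h p hh hp => ?_, fun h h' p p' hh hh' hp hp' => ?_⟩
  · refine (hK1 _ (hmem h p hh hp)).trans ?_
    have := le_abs_self K1
    have := K2.coe_nonneg
    linarith
  · have h1 := hK2.dist_le_mul _ (hmem h p hh hp) _ (hmem h' p' hh' hp')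
    rw [dist_eq_norm, dist_eq_norm] at h1
    refine h1.trans ?_
    have h2 : ‖((h, p) : System A × Coord l m) - (h', p')‖ ≤ ‖h - h'‖ + ‖p - p'‖ := by
      rw [Prod.mk_sub_mk, Prod.norm_mk]
      exact max_le (le_add_of_nonneg_right (norm_nonneg _)) (le_add_of_nonneg_left (norm_nonneg _))
    have := abs_nonneg K1
    gcongr
    linarith

end

section

variable {l m : ℕ}

/-! ### Uniform constants, associated zeros and the renormalized Newton step -/

/-- Constants that control the local maps of all systems with support `A` on the unit polydisk:
`K` compares the sup norm with `‖·‖_ω` and bounds the derivative of the model map, together with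
its Lipschitz constants; renormalizing at a point at distance at most `δ` changes the norms of
the coefficient vectors by a factor at most `2`. -/
structure IsRegularityBound (A : Supports l m) (K δ : ℝ) : Prop where
  one_le : 1 ≤ K
  delta_pos : 0 < δ
  delta_le : δ ≤ 1 / 4
  norm_le : ∀ u, ‖u‖ ≤ K * omegaSeminorm A u
  omega_le : ∀ u, omegaSeminorm A u ≤ K * ‖u‖
  deriv_le : ∀ (h : System A) (p u : Coord l m), ‖h‖ ≤ 1 → ‖p‖ ≤ 1 →
    ‖fderiv ℂ (model A h) p u‖ ≤ K * omegaSeminorm A u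
  lipschitz : ∀ (h h' : System A) (p p' u : Coord l m), ‖h‖ ≤ 1 → ‖h'‖ ≤ 1 → ‖p‖ ≤ 1 →
    ‖p'‖ ≤ 1 → ‖fderiv ℂ (model A h) p u - fderiv ℂ (model A h') p' u‖ ≤
      K * (‖h - h'‖ + omegaSeminorm A (p - p')) * omegaSeminorm A u
  rebase : ∀ (f : System A), (∀ i, f i ≠ 0) → ∀ ybar v : Fin m → ℂ, ‖v‖ ≤ δ →
    ∃ S : EuclideanSpace ℂ (Fin (l + m)) ≃L[ℂ] EuclideanSpace ℂ (Fin (l + m)),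
      (∀ p, localMap A f (ybar + v) p = S (localMap A f ybar (p + (0, v)))) ∧
      (∀ w, 1 / 2 * ‖w‖ ≤ ‖S w‖) ∧ ∀ w, ‖S w‖ ≤ 2 * ‖w‖

theorem LocallyNondegenerate.exists_isRegularityBound {A : Supports l m}
    (hA : LocallyNondegenerate A) : ∃ K δ : ℝ, IsRegularityBound A K δ := by
  obtain ⟨a, ha0, ha⟩ := hA.exists_norm_le
  obtain ⟨b, hb0, hb⟩ := exists_omegaSeminorm_le A
  obtain ⟨C, hC0, hC1, hC2⟩ := exists_fderiv_model_bound A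
  obtain ⟨δ, hδ, hS⟩ := exists_localMap_add A
  have hN : ∀ u, 0 ≤ omegaSeminorm A u := fun u => apply_nonneg _ u
  have hCa : 0 < C * a := by positivity
  have hCaa : 0 < C * a * a := by positivity
  refine ⟨1 + a + b + C * a + C * a * a, min δ (1 / 4), ?_, lt_min hδ (by norm_num),
    min_le_right _ _, fun u => ?_, fun u => ?_, fun h p u hh hp => ?_,
    fun h h' p p' u hh hh' hp hp' => ?_, fun f hf ybar v hv => ?_⟩
  · linarith
  · refine (ha u).trans ?_
    have := hN u
    gcongr
    linarith
  · refine (hb u).trans ?_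
    gcongr
    linarith
  · refine ((fderiv ℂ (model A h) p).le_opNorm u).trans ?_
    have h1 := hC1 h p hh hp
    have h2 := hN u
    calc ‖fderiv ℂ (model A h) p‖ * ‖u‖ ≤ C * (a * omegaSeminorm A u) :=
          mul_le_mul h1 (ha u) (norm_nonneg _) hC0.le
      _ = C * a * omegaSeminorm A u := by ring
      _ ≤ _ := by gcongr; linarith
  · rw [← sub_apply]
    refine (ContinuousLinearMap.le_opNorm _ u).trans ?_
    have h1 := hC2 h h' p p' hh hh' hp hp'
    have h2 := hN u
    have h3 := hN (p - p')
    have h4 := norm_nonneg (h - h')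
    have h5 := ha (p - p')
    calc ‖fderiv ℂ (model A h) p - fderiv ℂ (model A h') p'‖ * ‖u‖
        ≤ (C * (‖h - h'‖ + a * omegaSeminorm A (p - p'))) * (a * omegaSeminorm A u) := by
          refine mul_le_mul (h1.trans ?_) (ha u) (norm_nonneg _) (by positivity)
          gcongr
      _ = (C * a * ‖h - h'‖ + C * a * a * omegaSeminorm A (p - p')) * omegaSeminorm A u := by ring
      _ ≤ _ := by
          rw [mul_add (1 + a + b + C * a + C * a * a)]
          gcongr <;> linarith
  · exact hS f hf ybar v (hv.trans (min_le_left _ _))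

theorem fderiv_equiv_comp_add {S : EuclideanSpace ℂ (Fin (l + m)) ≃L[ℂ]
    EuclideanSpace ℂ (Fin (l + m))} {Q Q' : Coord l m → EuclideanSpace ℂ (Fin (l + m))}
    {v : Coord l m} (h : ∀ p, Q' p = S (Q (p + v))) (p : Coord l m) :
    fderiv ℂ Q' p = (S : EuclideanSpace ℂ (Fin (l + m)) →L[ℂ] _) ∘L fderiv ℂ Q (p + v) := by
  have h1 : Q' = S ∘ fun p => Q (p + v) := funext h
  rw [h1, ContinuousLinearEquiv.comp_fderiv, fderiv_comp_add_right]

theorem inverse_apply_equiv_comp_add {S : EuclideanSpace ℂ (Fin (l + m)) ≃L[ℂ]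
    EuclideanSpace ℂ (Fin (l + m))} {Q Q' : Coord l m → EuclideanSpace ℂ (Fin (l + m))}
    {v : Coord l m} (h : ∀ p, Q' p = S (Q (p + v))) (p : Coord l m) :
    (fderiv ℂ Q' p).inverse (Q' p) = (fderiv ℂ Q (p + v)).inverse (Q (p + v)) := by
  rw [fderiv_equiv_comp_add h, ContinuousLinearMap.inverse_equiv_comp, h]
  simp

/-- Newton iteration commutes with translations and is blind to a rescaling of the equations. -/
theorem newtonStep_iterate_equiv_comp_add {S : EuclideanSpace ℂ (Fin (l + m)) ≃L[ℂ]
    EuclideanSpace ℂ (Fin (l + m))} {Q Q' : Coord l m → EuclideanSpace ℂ (Fin (l + m))}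
    {v : Coord l m} (h : ∀ p, Q' p = S (Q (p + v))) (p : Coord l m) (s : ℕ) :
    (newtonStep Q')^[s] p + v = (newtonStep Q)^[s] (p + v) := by
  induction s with
  | zero => rfl
  | succ s ih =>
    rw [Function.iterate_succ_apply', Function.iterate_succ_apply', ← ih]
    simp only [newtonStep]
    rw [inverse_apply_equiv_comp_add h]
    abel

section

variable {A : Supports l m}

theorem differentiable_localMap (A : Supports l m) (f : System A) (ybar : Fin m → ℂ) :
    Differentiable ℂ (localMap A f ybar) := by
  rw [show localMap A f ybar = model A (unitSystem (renorm f ybar)) from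
    funext (localMap_eq_model A f ybar)]
  exact differentiable_model A _

theorem fderiv_localMap (A : Supports l m) (f : System A) (ybar : Fin m → ℂ) (p : Coord l m) :
    fderiv ℂ (localMap A f ybar) p = fderiv ℂ (model A (unitSystem (renorm f ybar))) p := by
  rw [show localMap A f ybar = model A (unitSystem (renorm f ybar)) from
    funext (localMap_eq_model A f ybar)]

namespace IsRegularityBound

variable {K δ : ℝ} (hb : IsRegularityBound A K δ)

include hb

theorem derivLipschitzOn (f : System A) (ybar : Fin m → ℂ) :
    DerivLipschitzOn (omegaSeminorm A) K (localMap A f ybar) (Metric.closedBall 0 1) := by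
  intro p hp p' hp' u
  rw [mem_closedBall_zero_iff] at hp hp'
  rw [fderiv_localMap, fderiv_localMap]
  have h := hb.lipschitz _ _ p p' u (norm_unitSystem_le (renorm f ybar))
    (norm_unitSystem_le (renorm f ybar)) hp hp'
  simpa using h

theorem leastGain_le (hA : LocallyNondegenerate A) (f : System A) (ybar : Fin m → ℂ)
    {p : Coord l m} (hp : ‖p‖ ≤ 1) : leastGain A (fderiv ℂ (localMap A f ybar) p) ≤ K :=
  hA.leastGain_le fun u => by
    rw [fderiv_localMap]
    exact hb.deriv_le _ p u (norm_unitSystem_le _) hp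

/-- Renormalizing at a nearby point changes the least gain by a factor at most `2`. -/
theorem leastGain_rebase (hA : LocallyNondegenerate A) {f : System A} (hf : ∀ i, f i ≠ 0)
    (ybar v : Fin m → ℂ) (hv : ‖v‖ ≤ δ) (p : Coord l m) :
    1 / 2 * leastGain A (fderiv ℂ (localMap A f ybar) (p + (0, v))) ≤
        leastGain A (fderiv ℂ (localMap A f (ybar + v)) p) ∧
      leastGain A (fderiv ℂ (localMap A f (ybar + v)) p) ≤
        2 * leastGain A (fderiv ℂ (localMap A f ybar) (p + (0, v))) := by
  obtain ⟨S, hS, h1, h2⟩ := hb.rebase f hf ybar v hv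
  rw [fderiv_equiv_comp_add hS]
  set M := fderiv ℂ (localMap A f ybar) (p + (0, v))
  constructor
  · refine hA.le_leastGain fun u => ?_
    have h3 := leastGain_mul_le A M u
    have h4 := h1 (M u)
    change _ ≤ ‖S (M u)‖
    linarith
  · have h5 : 1 / 2 * leastGain A ((S : EuclideanSpace ℂ (Fin (l + m)) →L[ℂ] _) ∘L M)
        ≤ leastGain A M := by
      refine hA.le_leastGain fun u => ?_
      have h3 := leastGain_mul_le A ((S : EuclideanSpace ℂ (Fin (l + m)) →L[ℂ] _) ∘L M) u
      have h4 := h2 (M u)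
      change _ ≤ ‖S (M u)‖ at h3
      linarith
    linarith

/-- The size of `α` for which the local analysis works. -/
theorem alpha_bounds {α : ℝ} (hα : 0 < α) (hαs : α ≤ δ / (4096 * K ^ 2)) :
    4096 * K * α ≤ 1 ∧ 2 * K ^ 2 * α ≤ δ := by
  have hK := hb.one_le
  have hδ := hb.delta_pos
  have hδ' := hb.delta_le
  rw [le_div_iff₀ (by positivity)] at hαs
  have hK2 : K ≤ K ^ 2 := by nlinarith
  constructor <;> nlinarith

/-- Since the least gain is at most `K`, a ball of radius `2 α κ` in `‖·‖_ω` about `(X, 0)` is small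
in the sup norm and stays inside the polydisk of radius `1/2`. -/
theorem norm_sub_le_of_omegaSeminorm_le (hA : LocallyNondegenerate A) {α : ℝ} (hα : 0 < α)
    (hαs : α ≤ δ / (4096 * K ^ 2)) {f : System A} {ybar : Fin m → ℂ} {X : Fin l → ℂ}
    (hX : ∀ k, ‖X k‖ ≤ 1 / 4) {p : Coord l m}
    (hp : omegaSeminorm A (p - (X, 0)) ≤
      2 * (α * leastGain A (fderiv ℂ (localMap A f ybar) (X, 0)))) :
    ‖p - (X, 0)‖ ≤ δ ∧ ‖p‖ ≤ 1 / 2 := by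
  have hK := hb.one_le
  have hX' : ‖((X, 0) : Coord l m)‖ ≤ 1 / 4 := by
    rw [Prod.norm_mk, norm_zero]
    exact max_le ((pi_norm_le_iff_of_nonneg (by norm_num)).2 hX) (by norm_num)
  have h1 := hb.leastGain_le hA f ybar (hX'.trans (by norm_num))
  have h2 := (hb.alpha_bounds hα hαs).2
  have h3 : ‖p - (X, 0)‖ ≤ δ := by
    refine (hb.norm_le _).trans ?_
    calc K * omegaSeminorm A (p - (X, 0)) ≤ K * (2 * (α * K)) := by
          gcongr
          exact hp.trans (by gcongr)
      _ = 2 * K ^ 2 * α := by ring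
      _ ≤ δ := h2
  refine ⟨h3, ?_⟩
  have h4 := norm_add_le (p - (X, 0)) ((X, 0) : Coord l m)
  rw [sub_add_cancel] at h4
  have := hb.delta_le
  linarith

/-- The zero associated with an approximate zero, and the least gain there. -/
theorem exists_associatedZero (hA : LocallyNondegenerate A) {α : ℝ} (hα : 0 < α)
    (hαs : α ≤ δ / (4096 * K ^ 2)) {f : System A} (hf : ∀ i, f i ≠ 0) {ybar : Fin m → ℂ}
    {X : Fin l → ℂ} (hX : ∀ k, ‖X k‖ ≤ 1 / 4) (h : IsApprox A α f ybar X) :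
    ∃ z, IsAssociatedZero A f ybar X z ∧
      omegaSeminorm A (z - (X, 0)) ≤ 2 * omegaSeminorm A
        ((fderiv ℂ (localMap A f ybar) (X, 0)).inverse (localMap A f ybar (X, 0))) ∧
      leastGain A (fderiv ℂ (localMap A f (ybar + z.2)) (z.1, 0)) ≤
        4 * leastGain A (fderiv ℂ (localMap A f ybar) (X, 0)) ∧
      leastGain A (fderiv ℂ (localMap A f ybar) (X, 0)) ≤
        4 * leastGain A (fderiv ℂ (localMap A f (ybar + z.2)) (z.1, 0)) := by
  have hK := hb.one_le
  set k := leastGain A (fderiv ℂ (localMap A f ybar) (X, 0)) with hk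
  set β := omegaSeminorm A
    ((fderiv ℂ (localMap A f ybar) (X, 0)).inverse (localMap A f ybar (X, 0))) with hβ
  have hβk : β ≤ α * k := h.le
  have hk0 : 0 < k := h.pos
  have hα1 := (hb.alpha_bounds hα hαs).1
  have hKβ : 16 * K * β ≤ 1 / 4 * k := by
    have : K * β ≤ K * (α * k) := by gcongr
    nlinarith
  have hin : ∀ p, omegaSeminorm A (p - (X, 0)) ≤ 2 * β → ‖p - (X, 0)‖ ≤ δ ∧ ‖p‖ ≤ 1 / 2 :=
    fun p hp => hb.norm_sub_le_of_omegaSeminorm_le hA hα hαs (f := f) (ybar := ybar) hX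
      (hp.trans (by linarith))
  obtain ⟨z, hz1, hz2, hz3, hz4, hz5⟩ := exists_zero_of_newtonStep
    hA.omegaSeminorm_eq_zero hb.norm_le (continuous_omegaSeminorm A) (finrank_coord l m)
    (differentiable_localMap A f ybar) (by linarith) (convex_closedBall 0 1)
    (hb.derivLipschitzOn f ybar) hk0
    (leastGain_mul_le A _) le_rfl (by linarith) (x := ((X, 0) : Coord l m))
    (fun p hp => mem_closedBall_zero_iff.2 ((hin p hp).2.trans (by norm_num)))
  have hβ0 : 0 ≤ β := apply_nonneg _ _
  have hz := hin z hz1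
  have hx := hin (X, 0) (by simpa using hβ0)
  have hlip : ∀ u, ‖fderiv ℂ (localMap A f ybar) (X, 0) u - fderiv ℂ (localMap A f ybar) z u‖
      ≤ 1 / 4 * k * omegaSeminorm A u := by
    intro u
    refine (hb.derivLipschitzOn f ybar _ (mem_closedBall_zero_iff.2 (hx.2.trans (by norm_num)))
      _ (mem_closedBall_zero_iff.2 (hz.2.trans (by norm_num))) u).trans ?_
    refine mul_le_mul_of_nonneg_right ?_ (apply_nonneg _ _)
    rw [map_sub_rev]
    have h1 : K * omegaSeminorm A (z - (X, 0)) ≤ K * (2 * β) := by gcongr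
    linarith
  have hg1 := hA.leastGain_sub_le hlip
  have hg2 := hA.leastGain_sub_le (M := fderiv ℂ (localMap A f ybar) z)
    (M' := fderiv ℂ (localMap A f ybar) (X, 0)) (δ := 1 / 4 * k) (fun u => by
      rw [norm_sub_rev]; exact hlip u)
  have hv : ‖z.2‖ ≤ δ := by
    have := (norm_snd_le (z - ((X, 0) : Coord l m))).trans hz.1
    simpa using this
  have hr := hb.leastGain_rebase hA hf ybar z.2 hv (z.1, 0)
  have hzz : ((z.1, 0) : Coord l m) + (0, z.2) = z := by ext <;> simp
  rw [hzz] at hr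
  refine ⟨z, ⟨hz3, hz2, hz4, fun s => ?_⟩, hz1, by linarith [hr.2], by linarith [hr.1]⟩
  rw [omegaNorm_eq, omegaNorm_eq]
  exact hz5 s

/-- One renormalized Newton step: the bound `α` for `β μ` improves to `α / 512`, and the Newton
sequence of the new point is the tail of the old one. -/
theorem isApprox_next (hA : LocallyNondegenerate A) {α : ℝ} (hα : 0 < α)
    (hαs : α ≤ δ / (4096 * K ^ 2)) {f : System A} (hf : ∀ i, f i ≠ 0) {ybar y' : Fin m → ℂ}
    {X X' : Fin l → ℂ} (hX : ∀ k, ‖X k‖ ≤ 1 / 4) (h : IsApprox A α f ybar X)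
    (hnext : ((X', y') : Coord l m) = (0, ybar) + newton (localMap A f ybar) (X, 0)) :
    IsApprox A (α / 512) f y' X' ∧
      ∀ s, (0, y') + (newton (localMap A f y'))^[s] (X', 0) =
        (0, ybar) + (newton (localMap A f ybar))^[s + 1] (X, 0) := by
  have hK := hb.one_le
  set Q := localMap A f ybar with hQ
  set k := leastGain A (fderiv ℂ Q (X, 0)) with hk
  set β := omegaSeminorm A ((fderiv ℂ Q (X, 0)).inverse (Q (X, 0))) with hβ
  have hβk : β ≤ α * k := h.le
  have hk0 : 0 < k := h.pos
  have hβ0 : 0 ≤ β := apply_nonneg _ _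
  have hα1 := (hb.alpha_bounds hα hαs).1
  have hKβ : 16 * K * β ≤ 1 / 4 * k := by
    have : K * β ≤ K * (α * k) := by gcongr
    nlinarith
  have hin : ∀ p, omegaSeminorm A (p - (X, 0)) ≤ 2 * β → ‖p - (X, 0)‖ ≤ δ ∧ ‖p‖ ≤ 1 / 2 :=
    fun p hp => hb.norm_sub_le_of_omegaSeminorm_le hA hα hαs (f := f) (ybar := ybar) hX
      (hp.trans (by linarith))
  have hball : ∀ p, omegaSeminorm A (p - (X, 0)) ≤ 2 * β →
      p ∈ Metric.closedBall (0 : Coord l m) 1 := fun p hp =>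
    mem_closedBall_zero_iff.2 ((hin p hp).2.trans (by norm_num))
  have est := newtonStep_iterate_estimates
    hA.omegaSeminorm_eq_zero (finrank_coord l m)
    (differentiable_localMap A f ybar) (by linarith) (convex_closedBall 0 1)
    (hb.derivLipschitzOn f ybar) hk0
    (leastGain_mul_le A _) le_rfl (by linarith) (x := ((X, 0) : Coord l m)) hball 1
  set p' := newtonStep Q (X, 0) with hp'
  simp only [Function.iterate_one] at est
  have hstep : omegaSeminorm A (p' - (X, 0)) = β := by
    rw [hp', newtonStep_sub, map_neg_eq_map]
  have hp'in := hin p' (by rw [hstep]; linarith)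
  have hpe : p' = (X', y' - ybar) := by
    have h1 : ((X', y') : Coord l m) = (0, ybar) + p' := hnext
    have h2 := congrArg Prod.fst h1
    have h3 := congrArg Prod.snd h1
    ext1
    · simpa using h2.symm
    · simp only [Prod.snd_add] at h3 ⊢
      rw [h3]; simp
  have hv : ‖y' - ybar‖ ≤ δ := by
    have := (norm_snd_le (p' - ((X, 0) : Coord l m))).trans hp'in.1
    rw [hpe] at this
    simpa using this
  obtain ⟨S, hS, hS1, hS2⟩ := hb.rebase f hf ybar (y' - ybar) hv
  rw [add_sub_cancel] at hS
  have hX'p : ((X', 0) : Coord l m) + (0, y' - ybar) = p' := by rw [hpe]; ext <;> simp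
  have hr := (hb.leastGain_rebase hA hf ybar (y' - ybar) hv (X', 0)).1
  rw [add_sub_cancel, hX'p] at hr
  have hk' : 7 / 8 * k ≤ leastGain A (fderiv ℂ Q p') := hA.le_leastGain est.2.1
  have hkk : 7 / 16 * k ≤ leastGain A (fderiv ℂ (localMap A f y') (X', 0)) := by linarith
  refine ⟨⟨by linarith, ?_⟩, fun s => ?_⟩
  · rw [inverse_apply_equiv_comp_add hS, hX'p]
    have hinv := isInvertible_of_lowerBound hA.omegaSeminorm_eq_zero (finrank_coord l m)
      (by linarith) est.2.1
    have hinv0 := isInvertible_of_lowerBound hA.omegaSeminorm_eq_zero (finrank_coord l m)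
      hk0 (leastGain_mul_le A (fderiv ℂ Q (X, 0)))
    have h1 := norm_apply_newtonStep_le (differentiable_localMap A f ybar) (by linarith)
      (convex_closedBall 0 1) (hb.derivLipschitzOn f ybar) (hball (X, 0) (by simpa using hβ0))
      (hball p' (by rw [hstep]; linarith)) hinv0
    have h2 := apply_inverse_le_of_lowerBound hinv (by linarith) est.2.1 (Q p')
    change ‖Q p'‖ ≤ K * omegaSeminorm A (p' - (X, 0)) ^ 2 at h1
    rw [hstep] at h1
    refine h2.trans ?_
    rw [div_le_iff₀ (by linarith)]
    refine h1.trans ?_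
    calc K * β ^ 2 ≤ K * (α * k) ^ 2 := by gcongr
      _ = (K * α) * (α * k * k) := by ring
      _ ≤ 1 / 4096 * (α * k * k) := by
          have : 0 ≤ α * k * k := by positivity
          gcongr
          linarith
      _ ≤ α / 512 * (7 / 16 * k) * (7 / 8 * k) := by
          have : 0 ≤ α * k * k := by positivity
          nlinarith
      _ ≤ _ := by gcongr
  · have h1 := newtonStep_iterate_equiv_comp_add hS (X', 0) s
    rw [hX'p, hp', ← Function.iterate_succ_apply] at h1
    have h2 : ((0, y') : Coord l m) = (0, ybar) + (0, y' - ybar) := by ext <;> simp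
    have h3 : (newton (localMap A f y'))^[s] (X', 0) + (0, y' - ybar) =
      (newton Q)^[s + 1] (X, 0) := h1
    rw [h2, ← h3]
    abel

end IsRegularityBound

end

end

section

variable {l m : ℕ}

/-! ### Lengths of paths, and horizontal lifts from projective space -/

theorem enorm_sub_le_lintegral_of_hasDerivAt {V : Type*} [NormedAddCommGroup V] [NormedSpace ℝ V]
    [CompleteSpace V] {γ γ' : ℝ → V} {a b : ℝ} (hab : a ≤ b) (hc : ContinuousOn γ (Icc a b))
    (hd : ∀ x ∈ Ioo a b, HasDerivAt γ (γ' x) x) (hc' : ContinuousOn γ' (Icc a b)) :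
    ‖γ b - γ a‖ₑ ≤ ∫⁻ x in Icc a b, ‖γ' x‖ₑ := by
  have hint : IntervalIntegrable γ' volume a b :=
    ContinuousOn.intervalIntegrable (by rwa [uIcc_of_le hab])
  rw [← intervalIntegral.integral_eq_sub_of_hasDerivAt_of_le hab hc hd hint,
    intervalIntegral.integral_of_le hab]
  refine (enorm_integral_le_lintegral_enorm _).trans ?_
  exact lintegral_mono_set Ioc_subset_Icc_self

theorem continuousAt_deriv_of_contDiffAt {V : Type*} [NormedAddCommGroup V] [NormedSpace ℝ V]
    {q : ℝ → V} {τ : ℝ} (h : ContDiffAt ℝ 1 q τ) : ContinuousAt (deriv q) τ := by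
  have h1 : ContinuousAt (fderiv ℝ q) τ := (h.fderiv_right (m := 0) (by simp)).continuousAt
  exact h1.clm_apply continuousAt_const

/-- A path of non-zero vectors, scaled to norm one, has up to a phase at its end point a chord no
longer than the Fubini-Study length of the projected path: multiply by
`exp (-∫ ⟨q, q'⟩ / ‖q‖ ^ 2)` to make it horizontal. -/
theorem exists_phase_enorm_sub_le {ι : Type*} [Fintype ι] {q : ℝ → EuclideanSpace ℂ ι} {a b : ℝ}
    (hab : a ≤ b) (hq : ∀ τ ∈ Icc a b, ContDiffAt ℝ 1 q τ) (hq0 : ∀ τ ∈ Icc a b, q τ ≠ 0) :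
    ∃ c : ℂ, ‖c‖ = 1 ∧ ‖c • ((‖q b‖ : ℂ)⁻¹ • q b) - (‖q a‖ : ℂ)⁻¹ • q a‖ₑ ≤
      ∫⁻ τ in Icc a b, ‖projTangent (q τ) (deriv q τ)‖ₑ := by
  set θ : ℝ → ℂ := fun τ => inner ℂ (q τ) (deriv q τ) / (‖q τ‖ : ℂ) ^ 2 with hθ
  have hn0 : ∀ τ ∈ Icc a b, (‖q τ‖ : ℂ) ≠ 0 := fun τ hτ => by
    exact_mod_cast norm_ne_zero_iff.2 (hq0 τ hτ)
  have hqc : ∀ τ ∈ Icc a b, ContinuousAt q τ := fun τ hτ => (hq τ hτ).continuousAt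
  have hdc : ∀ τ ∈ Icc a b, ContinuousAt (deriv q) τ := fun τ hτ =>
    continuousAt_deriv_of_contDiffAt (hq τ hτ)
  have hθc : ∀ τ ∈ Icc a b, ContinuousAt θ τ := fun τ hτ => by
    refine ContinuousAt.div ((hqc τ hτ).inner (hdc τ hτ)) ?_ (pow_ne_zero 2 (hn0 τ hτ))
    exact (Complex.continuous_ofReal.continuousAt.comp (hqc τ hτ).norm).pow 2
  have hθon : ContinuousOn θ (Icc a b) := fun τ hτ => (hθc τ hτ).continuousWithinAt
  set Φ : ℝ → ℂ := fun τ => ∫ x in a..τ, θ x with hΦ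
  have hΦc : ContinuousOn Φ (Icc a b) := by
    have h := intervalIntegral.continuousOn_primitive_interval (μ := volume) (f := θ) (a := a)
      (b := b) (by rw [uIcc_of_le hab]; exact hθon.integrableOn_Icc)
    rwa [uIcc_of_le hab] at h
  have hΦd : ∀ τ ∈ Ioo a b, HasDerivAt Φ (θ τ) τ := fun τ hτ => by
    refine intervalIntegral.integral_hasDerivAt_right ?_ ?_ (hθc τ (Ioo_subset_Icc_self hτ))
    · refine ContinuousOn.intervalIntegrable ?_
      rw [uIcc_of_le hτ.1.le]
      exact hθon.mono (Icc_subset_Icc_right hτ.2.le)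
    · exact ContinuousOn.stronglyMeasurableAtFilter isOpen_Ioo (hθon.mono Ioo_subset_Icc_self) τ hτ
  set e : ℝ → ℂ := fun τ => (‖q a‖ : ℂ)⁻¹ * Complex.exp (-Φ τ) with he
  set h : ℝ → EuclideanSpace ℂ ι := fun τ => e τ • q τ with hh
  set h' : ℝ → EuclideanSpace ℂ ι := fun τ => e τ • (deriv q τ - θ τ • q τ) with hh'
  have hec : ContinuousOn e (Icc a b) :=
    continuousOn_const.mul (Complex.continuous_exp.comp_continuousOn hΦc.neg)
  have hqon : ContinuousOn q (Icc a b) := fun τ hτ => (hqc τ hτ).continuousWithinAt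
  have hdon : ContinuousOn (deriv q) (Icc a b) := fun τ hτ => (hdc τ hτ).continuousWithinAt
  have hhc : ContinuousOn h (Icc a b) := hec.smul hqon
  have hh'c : ContinuousOn h' (Icc a b) := hec.smul (hdon.sub (hθon.smul hqon))
  have hhd : ∀ τ ∈ Ioo a b, HasDerivAt h (h' τ) τ := fun τ hτ => by
    have h1 : HasDerivAt e (e τ * -θ τ) τ := by
      have := ((hΦd τ hτ).neg.cexp).const_mul ((‖q a‖ : ℂ)⁻¹)
      rw [← mul_assoc] at this
      exact this
    have h2 : HasDerivAt q (deriv q τ) τ :=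
      ((hq τ (Ioo_subset_Icc_self hτ)).differentiableAt one_ne_zero).hasDerivAt
    have h3 := h1.smul h2
    have h4 : h' τ = e τ • deriv q τ + (e τ * -θ τ) • q τ := by
      simp only [hh']
      module
    rw [h4]
    exact h3
  have hperp : ∀ τ ∈ Icc a b, inner ℂ (h τ) (h' τ) = 0 := fun τ hτ => by
    have h1 : inner ℂ (q τ) (deriv q τ - θ τ • q τ) = 0 := by
      rw [inner_sub_right, inner_smul_right, inner_self_eq_norm_sq_to_K, hθ]
      have := hn0 τ hτ
      simp only [Complex.coe_algebraMap]
      field_simp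
      ring
    simp only [hh, hh', inner_smul_left, inner_smul_right, h1, mul_zero]
  have hha : h a = (‖q a‖ : ℂ)⁻¹ • q a := by simp [hh, he, hΦ]
  have ha : a ∈ Icc a b := left_mem_Icc.2 hab
  -- the lift is horizontal, hence of constant norm
  have hnorm : ∀ τ ∈ Icc a b, ‖h τ‖ = 1 := fun τ hτ => by
    have h1 : ∀ x ∈ Ioo a τ, HasDerivAt (fun x => inner ℂ (h x) (h x)) (0 : ℂ) x := fun x hx => by
      have hx' : x ∈ Ioo a b := ⟨hx.1, hx.2.trans_le hτ.2⟩
      have h2 := (hhd x hx').inner ℂ (hhd x hx')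
      have h3 := hperp x (Ioo_subset_Icc_self hx')
      rw [h3, inner_eq_zero_symm.1 h3, add_zero] at h2
      exact h2
    have h2 := intervalIntegral.integral_eq_sub_of_hasDerivAt_of_le hτ.1
      ((hhc.inner hhc).mono (Icc_subset_Icc_right hτ.2)) h1 (by simp)
    rw [intervalIntegral.integral_zero, eq_comm, sub_eq_zero, inner_self_eq_norm_sq_to_K,
      inner_self_eq_norm_sq_to_K] at h2
    have h4 : ‖h τ‖ ^ 2 = ‖h a‖ ^ 2 := by exact_mod_cast h2
    have h5 : ‖h a‖ = 1 := by
      rw [hha, norm_smul, norm_inv, Complex.norm_real, norm_norm,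
        inv_mul_cancel₀ (norm_ne_zero_iff.2 (hq0 a ha))]
    rw [h5] at h4
    exact (pow_left_inj₀ (norm_nonneg _) zero_le_one two_ne_zero).1 h4
  have hen : ∀ τ ∈ Icc a b, ‖e τ‖ = ‖q τ‖⁻¹ := fun τ hτ => by
    have h1 := hnorm τ hτ
    rw [hh, norm_smul] at h1
    exact eq_inv_of_mul_eq_one_left h1
  have hmain := enorm_sub_le_lintegral_of_hasDerivAt hab hhc hhd hh'c
  have hb : b ∈ Icc a b := right_mem_Icc.2 hab
  refine ⟨e b * ‖q b‖, ?_, ?_⟩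
  · rw [norm_mul, hen b hb, Complex.norm_real, norm_norm,
      inv_mul_cancel₀ (norm_ne_zero_iff.2 (hq0 b hb))]
  · rw [smul_smul, mul_assoc, mul_inv_cancel₀ (hn0 b hb), mul_one, ← hha]
    refine hmain.trans (le_of_eq (setLIntegral_congr_fun measurableSet_Icc fun τ hτ => ?_))
    simp only [← ofReal_norm]
    congr 1
    rw [hh', norm_smul, hen τ hτ, projTangent, norm_smul, norm_inv, Complex.norm_real, norm_norm]

/-- An integral bound in the open interval extends to the end points by continuity. -/
theorem ofReal_le_lintegral_Icc_of_Ioo {a b : ℝ} {φ : ℝ → ℝ → ℝ} {w : ℝ → ℝ≥0∞} {L : ℝ≥0∞}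
    (hφ : ContinuousOn (fun x : ℝ × ℝ => φ x.1 x.2) (Icc a b ×ˢ Icc a b))
    (h : ∀ s t, a < s → s ≤ t → t < b → ENNReal.ofReal (φ s t) ≤ L * ∫⁻ τ in Icc s t, w τ)
    {s t : ℝ} (has : a ≤ s) (hst : s < t) (htb : t ≤ b) :
    ENNReal.ofReal (φ s t) ≤ L * ∫⁻ τ in Icc s t, w τ := by
  have hlim : Tendsto (fun η : ℝ => ((s + η, t - η) : ℝ × ℝ)) (𝓝[>] 0)
      (𝓝[Icc a b ×ˢ Icc a b] (s, t)) := by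
    refine tendsto_nhdsWithin_iff.2 ⟨?_, ?_⟩
    · have : Continuous (fun η : ℝ => ((s + η, t - η) : ℝ × ℝ)) := by fun_prop
      have h1 := this.tendsto 0
      simp only [add_zero, sub_zero] at h1
      exact h1.mono_left nhdsWithin_le_nhds
    · filter_upwards [Ioo_mem_nhdsGT (show (0 : ℝ) < (t - s) / 2 by linarith)] with η hη
      exact ⟨⟨by linarith [hη.1], by linarith [hη.2]⟩, ⟨by linarith [hη.2], by linarith [hη.1]⟩⟩
  have h2 := (hφ (s, t) ⟨⟨has, by linarith⟩, ⟨by linarith, htb⟩⟩).tendsto.comp hlim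
  refine le_of_tendsto ((ENNReal.continuous_ofReal.tendsto _).comp h2) ?_
  filter_upwards [Ioo_mem_nhdsGT (show (0 : ℝ) < (t - s) / 2 by linarith)] with η hη
  refine (h (s + η) (t - η) (by linarith [hη.1]) (by linarith [hη.2])
    (by linarith [hη.1])).trans ?_
  gcongr <;> linarith [hη.1]

/-- If `κ` decreases at rate at most `L w`, and `∫ w / κ` is small, then `κ` at most halves. -/
theorem le_two_mul_of_lintegral_le {a b L ε : ℝ} {κ : ℝ → ℝ} {w : ℝ → ℝ≥0∞}
    (hκ : ContinuousOn κ (Icc a b)) (hL : 0 ≤ L) (hε : 0 ≤ ε) (hLε : 2 * L * ε < 1)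
    (hvar : ∀ s t, a < s → s ≤ t → t < b →
      ENNReal.ofReal (κ s - κ t) ≤ ENNReal.ofReal L * ∫⁻ τ in Icc s t, w τ)
    (hint : ∫⁻ τ in Icc a b, w τ * (ENNReal.ofReal (κ τ))⁻¹ ≤ ENNReal.ofReal ε)
    (hb : 0 < κ b) :
    (∀ τ ∈ Icc a b, κ τ ≤ 2 * κ b) ∧
      ∫⁻ τ in Icc a b, w τ ≤ ENNReal.ofReal (2 * κ b * ε) := by
  have key : ∀ σ ∈ Icc a b, (∀ τ ∈ Ioc σ b, κ τ ≤ 2 * κ b) →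
      ∫⁻ τ in Icc σ b, w τ ≤ ENNReal.ofReal (2 * κ b * ε) := by
    intro σ hσ h
    rw [ENNReal.ofReal_mul (by positivity)]
    have hB0 : ENNReal.ofReal (2 * κ b) ≠ 0 := by
      rw [ne_eq, ENNReal.ofReal_eq_zero]; linarith
    calc ∫⁻ τ in Icc σ b, w τ = ∫⁻ τ in Ioc σ b, w τ :=
          setLIntegral_congr Ioc_ae_eq_Icc.symm
      _ ≤ ∫⁻ τ in Ioc σ b, ENNReal.ofReal (2 * κ b) * (w τ * (ENNReal.ofReal (κ τ))⁻¹) := by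
          refine setLIntegral_mono' measurableSet_Ioc fun τ hτ => ?_
          have h1 : 1 ≤ ENNReal.ofReal (2 * κ b) * (ENNReal.ofReal (κ τ))⁻¹ := by
            rw [← ENNReal.mul_inv_cancel hB0 ENNReal.ofReal_ne_top]
            gcongr
            exact h τ hτ
          calc w τ = w τ * 1 := (mul_one _).symm
            _ ≤ w τ * (ENNReal.ofReal (2 * κ b) * (ENNReal.ofReal (κ τ))⁻¹) := by gcongr
            _ = _ := by ring
      _ = ENNReal.ofReal (2 * κ b) * ∫⁻ τ in Ioc σ b, w τ * (ENNReal.ofReal (κ τ))⁻¹ :=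
          lintegral_const_mul' _ _ ENNReal.ofReal_ne_top
      _ ≤ ENNReal.ofReal (2 * κ b) * ENNReal.ofReal ε := by
          gcongr
          refine le_trans (lintegral_mono_set ?_) hint
          exact Ioc_subset_Icc_self.trans (Icc_subset_Icc_left hσ.1)
  have hall : ∀ τ ∈ Icc a b, κ τ ≤ 2 * κ b := by
    by_contra! hcon
    obtain ⟨τ, hτ, hlt⟩ := hcon
    -- the last time at which `κ` is at least twice its final value
    have hsub : Icc τ b ⊆ Icc a b := Icc_subset_Icc_left hτ.1
    have hcl : IsCompact (Icc τ b ∩ κ ⁻¹' Ici (2 * κ b)) :=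
      isCompact_Icc.of_isClosed_subset
        ((hκ.mono hsub).preimage_isClosed_of_isClosed isClosed_Icc isClosed_Ici) inter_subset_left
    obtain ⟨σ, ⟨hσ1, hσ2⟩, hσ3⟩ := hcl.exists_isGreatest
      ⟨τ, ⟨left_mem_Icc.2 hτ.2, hlt.le⟩⟩
    have hσ2' : 2 * κ b ≤ κ σ := hσ2
    have hσb : σ < b := by
      refine lt_of_le_of_ne hσ1.2 fun h => ?_
      rw [h] at hσ2'
      linarith
    have h1 := key σ (hsub hσ1) fun t ht => by
      by_contra! hgt
      exact absurd (hσ3 ⟨⟨hσ1.1.trans ht.1.le, ht.2⟩, hgt.le⟩) (not_le.2 ht.1)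
    have h2 := ofReal_le_lintegral_Icc_of_Ioo (φ := fun s t => κ s - κ t) (w := w)
      ((hκ.comp continuousOn_fst fun x hx => hx.1).sub
        (hκ.comp continuousOn_snd fun x hx => hx.2)) hvar (hsub hσ1).1 hσb le_rfl
    have h3 : ENNReal.ofReal (κ b) ≤ ENNReal.ofReal (L * (2 * κ b * ε)) := by
      refine (ENNReal.ofReal_le_ofReal (by linarith)).trans (h2.trans ?_)
      rw [ENNReal.ofReal_mul hL]
      gcongr
    rw [ENNReal.ofReal_le_ofReal_iff (by positivity)] at h3
    nlinarith
  refine ⟨hall, ?_⟩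
  rcases le_or_gt a b with hab | hab
  · exact key a (left_mem_Icc.2 hab) fun τ hτ => hall τ (Ioc_subset_Icc_self hτ)
  · simp [Icc_eq_empty_of_lt hab]

/-! ### The path of zeros -/

section

variable {A : Supports l m}

theorem contDiff_renorm (A : Supports l m) (i : Fin (l + m)) {n : WithTop ℕ∞} :
    ContDiff ℂ n (fun x : System A × (Fin m → ℂ) => renorm x.1 x.2 i) := by
  refine (contDiff_piLp 2).2 fun a => ?_
  simp only [renorm]
  have h1 : ContDiff ℂ n (fun x : System A × (Fin m → ℂ) => x.1 i a) :=
    (contDiff_piLp 2).1 ((contDiff_pi.1 contDiff_fst) i) a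
  exact h1.mul (by fun_prop)

/-- The local map is the unnormalized model map up to a translation and a rescaling. -/
theorem exists_localMap_eq_model {f : System A} (hf : ∀ i, f i ≠ 0) (ybar : Fin m → ℂ) :
    ∃ S : EuclideanSpace ℂ (Fin (l + m)) ≃L[ℂ] EuclideanSpace ℂ (Fin (l + m)),
      ∀ p, localMap A f ybar p = S (model A f (p + (0, ybar))) := by
  have hs : ∀ i, ((‖renorm f ybar i‖ : ℂ)⁻¹) ≠ 0 := fun i => by
    have := norm_ne_zero_iff.2 (renorm_ne_zero hf ybar i)
    exact inv_ne_zero (by exact_mod_cast this)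
  refine ⟨diagScale _ hs, fun p => ?_⟩
  ext i
  rw [diagScale_apply, localMap_apply, model_renorm, div_eq_inv_mul]

/-- By the implicit function theorem a continuous path of non-degenerate zeros is `C^1`. -/
theorem contDiffAt_of_implicit {H E F : Type*} [NormedAddCommGroup H] [NormedSpace ℂ H]
    [NormedAddCommGroup E] [NormedSpace ℂ E] [CompleteSpace E]
    [NormedAddCommGroup F] [NormedSpace ℂ F] [CompleteSpace F]
    {Ψ : H → E → F} (hΨ : ContDiff ℂ 1 (fun x : H × E => Ψ x.1 x.2))
    {g : ℝ → H} {ζ : ℝ → E} {τ₀ : ℝ}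
    (hg : ContDiffAt ℝ 1 g τ₀) (hζ : ContinuousAt ζ τ₀)
    (hzero : ∀ᶠ τ in 𝓝 τ₀, Ψ (g τ) (ζ τ) = 0)
    (hinv : (fderiv ℂ (Ψ (g τ₀)) (ζ τ₀)).IsInvertible) : ContDiffAt ℝ 1 ζ τ₀ := by
  set f : ℝ × E → F := fun x => Ψ (g x.1) x.2 with hf
  have hcd : ContDiffAt ℝ 1 f (τ₀, ζ τ₀) := by
    have h1 : ContDiffAt ℝ 1 (fun x : ℝ × E => ((g x.1, x.2) : H × E)) (τ₀, ζ τ₀) :=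
      (ContDiffAt.comp (x := (τ₀, ζ τ₀)) (g := g) hg contDiffAt_fst).prodMk contDiffAt_snd
    exact (hΨ.restrict_scalars ℝ).contDiffAt.comp (τ₀, ζ τ₀) h1
  have hdiff : DifferentiableAt ℂ (Ψ (g τ₀)) (ζ τ₀) :=
    ((hΨ.comp (contDiff_const.prodMk contDiff_id)).differentiable one_ne_zero) (ζ τ₀)
  have hpart : fderiv ℝ f (τ₀, ζ τ₀) ∘L .inr ℝ ℝ E =
      (fderiv ℂ (Ψ (g τ₀)) (ζ τ₀)).restrictScalars ℝ := by
    have h1 : HasFDerivAt (fun p : E => f (τ₀, p))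
        (fderiv ℝ f (τ₀, ζ τ₀) ∘L .inr ℝ ℝ E) (ζ τ₀) :=
      (hcd.differentiableAt one_ne_zero).hasFDerivAt.comp (ζ τ₀)
        (hasFDerivAt_prodMk_right τ₀ (ζ τ₀))
    exact h1.unique (hdiff.hasFDerivAt.restrictScalars ℝ)
  have hinv' : (fderiv ℝ f (τ₀, ζ τ₀) ∘L .inr ℝ ℝ E).IsInvertible := by
    rw [hpart]
    refine ContinuousLinearMap.IsInvertible.of_inverse
      (g := (fderiv ℂ (Ψ (g τ₀)) (ζ τ₀)).inverse.restrictScalars ℝ) ?_ ?_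
    · ext w
      exact hinv.self_apply_inverse w
    · ext u
      exact hinv.inverse_apply_self u
  have hev := hcd.eventually_apply_eq_iff_implicitFunction one_ne_zero hinv'
  have hpath : Tendsto (fun τ => (τ, ζ τ)) (𝓝 τ₀) (𝓝 (τ₀, ζ τ₀)) :=
    continuousAt_id.prodMk hζ
  refine (hcd.contDiffAt_implicitFunction one_ne_zero hinv').congr_of_eventuallyEq ?_
  have h0 := hzero.self_of_nhds
  filter_upwards [hpath.eventually hev, hzero] with τ h1 h2
  exact (h1.1 (h2.trans h0.symm)).symm

theorem contDiffAt_of_model_eq_zero {g : ℝ → System A} {ζ : ℝ → Coord l m} {τ₀ : ℝ}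
    (hg : ContDiffAt ℝ 1 g τ₀) (hζ : ContinuousAt ζ τ₀)
    (hzero : ∀ᶠ τ in 𝓝 τ₀, model A (g τ) (ζ τ) = 0)
    (hinv : (fderiv ℂ (model A (g τ₀)) (ζ τ₀)).IsInvertible) : ContDiffAt ℝ 1 ζ τ₀ :=
  contDiffAt_of_implicit (contDiff_model A) hg hζ hzero hinv

end

end

section

variable {l m : ℕ} {A : Supports l m}

/-! ### Dependence of the least gain on the system -/

theorem LocallyNondegenerate.continuous_leastGain (hA : LocallyNondegenerate A) :
    Continuous (leastGain A) := by
  obtain ⟨a, ha0, ha⟩ := hA.exists_norm_le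
  have h : ∀ M M' : Coord l m →L[ℂ] EuclideanSpace ℂ (Fin (l + m)),
      leastGain A M - a * ‖M - M'‖ ≤ leastGain A M' := fun M M' =>
    hA.leastGain_sub_le fun u => by
      have h1 := (M - M').le_opNorm u
      have h2 := mul_le_mul_of_nonneg_left (ha u) (norm_nonneg (M - M'))
      rw [sub_apply] at h1
      linarith
  refine (LipschitzWith.of_dist_le_mul (K := ⟨a, ha0.le⟩) fun M M' => ?_).continuous
  rw [Real.dist_eq, dist_eq_norm, abs_le]
  have h1 := h M M'
  have h2 := h M' M
  rw [norm_sub_rev] at h2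
  constructor
  · change -(a * ‖M - M'‖) ≤ _
    linarith
  · change _ ≤ a * ‖M - M'‖
    linarith

section Continuity

variable {g : ℝ → System A} {s : Set ℝ} {y : ℝ → Fin m → ℂ} {p : ℝ → Coord l m}

theorem continuousOn_unitSystem_renorm (hg : ContinuousOn g s) (hg0 : ∀ τ ∈ s, ∀ i, g τ i ≠ 0)
    (hy : ContinuousOn y s) : ContinuousOn (fun τ => unitSystem (renorm (g τ) (y τ))) s := by
  refine continuousOn_pi.2 fun i => ?_
  have h1 : ContinuousOn (fun τ => renorm (g τ) (y τ) i) s :=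
    (contDiff_renorm A i (n := 0)).continuous.comp_continuousOn (hg.prodMk hy)
  have h2 : ContinuousOn (fun τ => (‖renorm (g τ) (y τ) i‖ : ℂ)) s :=
    Complex.continuous_ofReal.comp_continuousOn h1.norm
  refine (h2.inv₀ fun τ hτ => ?_).smul h1
  exact_mod_cast norm_ne_zero_iff.2 (renorm_ne_zero (hg0 τ hτ) _ i)

theorem continuousOn_apply₂ {H E F : Type*} [TopologicalSpace H] [TopologicalSpace E]
    [TopologicalSpace F] {Ψ : H → E → F} (hΨ : Continuous (fun x : H × E => Ψ x.1 x.2))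
    {h : ℝ → H} {p : ℝ → E} (hh : ContinuousOn h s) (hp : ContinuousOn p s) :
    ContinuousOn (fun τ => Ψ (h τ) (p τ)) s :=
  hΨ.comp_continuousOn (hh.prodMk hp)

theorem continuousOn_localMap (hg : ContinuousOn g s) (hg0 : ∀ τ ∈ s, ∀ i, g τ i ≠ 0)
    (hy : ContinuousOn y s) (hp : ContinuousOn p s) :
    ContinuousOn (fun τ => localMap A (g τ) (y τ) (p τ)) s := by
  simp only [localMap_eq_model]
  exact continuousOn_apply₂ (Ψ := model A) (contDiff_model A (n := 0)).continuous
    (continuousOn_unitSystem_renorm hg hg0 hy) hp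

theorem continuousOn_fderiv_localMap (hg : ContinuousOn g s) (hg0 : ∀ τ ∈ s, ∀ i, g τ i ≠ 0)
    (hy : ContinuousOn y s) (hp : ContinuousOn p s) :
    ContinuousOn (fun τ => fderiv ℂ (localMap A (g τ) (y τ)) (p τ)) s := by
  simp only [fderiv_localMap]
  exact continuousOn_apply₂ (Ψ := fun h p => fderiv ℂ (model A h) p)
    (contDiff_fderiv_model A (n := 0)).continuous (continuousOn_unitSystem_renorm hg hg0 hy) hp

/-- `β` is continuous where the derivative is invertible. -/
theorem LocallyNondegenerate.continuousWithinAt_beta (hA : LocallyNondegenerate A)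
    (hg : ContinuousOn g s) (hg0 : ∀ τ ∈ s, ∀ i, g τ i ≠ 0) (ybar : Fin m → ℂ) (X : Fin l → ℂ)
    {τ₀ : ℝ} (hτ₀ : τ₀ ∈ s)
    (hpos : 0 < leastGain A (fderiv ℂ (localMap A (g τ₀) ybar) (X, 0))) :
    ContinuousWithinAt (fun τ => omegaSeminorm A ((fderiv ℂ (localMap A (g τ) ybar) (X, 0)).inverse
      (localMap A (g τ) ybar (X, 0)))) s τ₀ := by
  have h1 := continuousOn_localMap hg hg0 (y := fun _ => ybar) (p := fun _ => (X, 0))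
    continuousOn_const continuousOn_const τ₀ hτ₀
  have h2 := continuousOn_fderiv_localMap hg hg0 (y := fun _ => ybar) (p := fun _ => (X, 0))
    continuousOn_const continuousOn_const τ₀ hτ₀
  have h3 : ContinuousAt ContinuousLinearMap.inverse (fderiv ℂ (localMap A (g τ₀) ybar) (X, 0)) :=
    ((hA.isInvertible_of_leastGain_pos hpos).contDiffAt_map_inverse (n := 0)).continuousAt
  exact (continuous_omegaSeminorm A).continuousAt.comp_continuousWithinAt
    ((ContinuousAt.comp_continuousWithinAt
      (f := fun τ => fderiv ℂ (localMap A (g τ) ybar) (X, 0)) h3 h2).clm_apply h1)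

/-- Being an approximate zero with a smaller constant is an open condition in time. -/
theorem LocallyNondegenerate.eventually_isApprox (hA : LocallyNondegenerate A)
    (hg : ContinuousOn g s) (hg0 : ∀ τ ∈ s, ∀ i, g τ i ≠ 0) {ybar : Fin m → ℂ} {X : Fin l → ℂ}
    {τ₀ α' α : ℝ} (hτ₀ : τ₀ ∈ s) (hα : α' < α) (h : IsApprox A α' (g τ₀) ybar X) :
    ∀ᶠ τ in 𝓝[s] τ₀, IsApprox A α (g τ) ybar X := by
  have h1 := hA.continuousWithinAt_beta hg hg0 ybar X hτ₀ h.pos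
  have h2 : ContinuousWithinAt (fun τ => leastGain A (fderiv ℂ (localMap A (g τ) ybar) (X, 0)))
      s τ₀ := hA.continuous_leastGain.continuousAt.comp_continuousWithinAt
    (continuousOn_fderiv_localMap hg hg0 (y := fun _ => ybar) (p := fun _ => (X, 0))
    continuousOn_const continuousOn_const τ₀ hτ₀)
  have h3 := h1.eventually_lt (h2.const_mul α)
    (h.le.trans_lt (mul_lt_mul_of_pos_right hα h.pos))
  filter_upwards [h3, h2.eventually_const_lt h.pos] with τ h4 h5
  exact ⟨h5, h4.le⟩

/-- Being an approximate zero persists in the limit, as long as the derivative does not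
degenerate. -/
theorem LocallyNondegenerate.isApprox_of_frequently (hA : LocallyNondegenerate A)
    (hg : ContinuousOn g s) (hg0 : ∀ τ ∈ s, ∀ i, g τ i ≠ 0) {ybar : Fin m → ℂ} {X : Fin l → ℂ}
    {τ₀ α c : ℝ} (hτ₀ : τ₀ ∈ s) (hc : 0 < c)
    (h : ∃ᶠ τ in 𝓝[s] τ₀, IsApprox A α (g τ) ybar X ∧
      c ≤ leastGain A (fderiv ℂ (localMap A (g τ) ybar) (X, 0))) :
    IsApprox A α (g τ₀) ybar X := by
  have h2 : ContinuousWithinAt (fun τ => leastGain A (fderiv ℂ (localMap A (g τ) ybar) (X, 0)))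
      s τ₀ := hA.continuous_leastGain.continuousAt.comp_continuousWithinAt
    (continuousOn_fderiv_localMap hg hg0 (y := fun _ => ybar) (p := fun _ => (X, 0))
    continuousOn_const continuousOn_const τ₀ hτ₀)
  have hpos : 0 < leastGain A (fderiv ℂ (localMap A (g τ₀) ybar) (X, 0)) := by
    by_contra hneg
    have h3 := h2.eventually_lt_const (lt_of_le_of_lt (not_lt.1 hneg) hc)
    obtain ⟨τ, h4, h5⟩ := (h.and_eventually h3).exists
    linarith [h4.2]
  have h1 := hA.continuousWithinAt_beta hg hg0 ybar X hτ₀ hpos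
  refine ⟨hpos, ?_⟩
  by_contra hneg
  have h3 := (h2.const_mul α).eventually_lt h1 (not_le.1 hneg)
  obtain ⟨τ, h4, h5⟩ := (h.and_eventually h3).exists
  linarith [h4.1.le]

end Continuity

/-! ### Variation of the least gain along the path of zeros -/

/-- The least gain along a path of zeros: the inverse of the condition number there. -/
noncomputable def pathGain (A : Supports l m) (g : ℝ → System A) (ζ : ℝ → Coord l m) (τ : ℝ) : ℝ :=
  leastGain A (fderiv ℂ (localMap A (g τ) (ζ τ).2) ((ζ τ).1, 0))

/-- The integrand of the condition length without the condition number. -/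
noncomputable def pathSpeed (A : Supports l m) (g : ℝ → System A) (ζ : ℝ → Coord l m) (τ : ℝ) :
    ℝ≥0∞ :=
  ENNReal.ofReal (renormSpeed A g (fun s => (ζ s).2) τ) + ENNReal.ofReal (omegaNorm A (deriv ζ τ))

theorem LocallyNondegenerate.renormLength_eq (hA : LocallyNondegenerate A) (g : ℝ → System A)
    (ζ : ℝ → Coord l m) (a b : ℝ) : renormLength A g ζ a b =
      ∫⁻ τ in Icc a b, pathSpeed A g ζ τ * (ENNReal.ofReal (pathGain A g ζ τ))⁻¹ := by
  simp only [renormLength, pathSpeed, pathGain, mu, hA.invNorm_eq]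

theorem ofReal_omegaSeminorm_sub_le {ζ : ℝ → Coord l m} {a b : ℝ} (hab : a ≤ b)
    (hζ : ∀ τ ∈ Icc a b, ContDiffAt ℝ 1 ζ τ) :
    ENNReal.ofReal (omegaSeminorm A (ζ b - ζ a)) ≤
      ∫⁻ τ in Icc a b, ENNReal.ofReal (omegaNorm A (deriv ζ τ)) := by
  set T : Coord l m →L[ℝ] PiLp 2 (fun i => EuclideanSpace ℂ (A i)) :=
    (omegaLinear A).toContinuousLinearMap.restrictScalars ℝ with hT
  have h := enorm_sub_le_lintegral_of_hasDerivAt (γ := fun τ => T (ζ τ))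
    (γ' := fun τ => T (deriv ζ τ)) hab
    (fun τ hτ => (T.continuous.continuousAt.comp (hζ τ hτ).continuousAt).continuousWithinAt)
    (fun τ hτ => T.hasFDerivAt.comp_hasDerivAt τ
      ((hζ τ (Ioo_subset_Icc_self hτ)).differentiableAt one_ne_zero).hasDerivAt)
    (fun τ hτ => (T.continuous.continuousAt.comp
      (continuousAt_deriv_of_contDiffAt (hζ τ hτ))).continuousWithinAt)
  rw [← map_sub, ← ofReal_norm] at h
  refine h.trans (le_of_eq ?_)
  refine lintegral_congr fun τ => ?_
  rw [← ofReal_norm, omegaNorm_eq]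
  rfl

/-- Along a path of zeros the least gain decreases at most at the rate `K ^ 3` times the speed. -/
theorem IsRegularityBound.ofReal_pathGain_sub_le {K δ : ℝ} (hb : IsRegularityBound A K δ)
    (hA : LocallyNondegenerate A) {g : ℝ → System A} {ζ : ℝ → Coord l m} {a b : ℝ} (hab : a ≤ b)
    (hg : ∀ τ ∈ Icc a b, ContDiffAt ℝ 1 g τ) (hg0 : ∀ τ ∈ Icc a b, ∀ i, g τ i ≠ 0)
    (hζ : ∀ τ ∈ Icc a b, ContDiffAt ℝ 1 ζ τ) (hX : ∀ τ ∈ Icc a b, ‖(ζ τ).1‖ ≤ 1) :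
    ENNReal.ofReal (pathGain A g ζ a - pathGain A g ζ b) ≤
      ENNReal.ofReal (K ^ 3) * ∫⁻ τ in Icc a b, pathSpeed A g ζ τ := by
  have hK := hb.one_le
  set q : ∀ i, ℝ → EuclideanSpace ℂ (A i) := fun i τ => renorm (g τ) (ζ τ).2 i with hq
  have hqd : ∀ i, ∀ τ ∈ Icc a b, ContDiffAt ℝ 1 (q i) τ := fun i τ hτ =>
    ContDiffAt.comp (g := fun x : System A × (Fin m → ℂ) => renorm x.1 x.2 i) τ
      ((contDiff_renorm A i).restrict_scalars ℝ).contDiffAt ((hg τ hτ).prodMk (hζ τ hτ).snd)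
  have hq0 : ∀ i, ∀ τ ∈ Icc a b, q i τ ≠ 0 := fun i τ hτ => renorm_ne_zero (hg0 τ hτ) _ i
  choose c hc1 hc2 using fun i => exists_phase_enorm_sub_le hab (hqd i) (hq0 i)
  have hc0 : ∀ i, c i ≠ 0 := fun i => by rw [← norm_pos_iff, hc1]; exact one_pos
  set ha := unitSystem (renorm (g a) (ζ a).2) with hha
  set hb' := scaleSystem c (unitSystem (renorm (g b) (ζ b).2)) with hhb
  -- the phases do not change the least gain
  have hphase : leastGain A (fderiv ℂ (model A hb') ((ζ b).1, 0)) ≤ pathGain A g ζ b := by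
    refine hA.le_leastGain fun u => (leastGain_mul_le A _ u).trans (le_of_eq ?_)
    have h1 : ∀ p, model A hb' p = diagScale c hc0 (localMap A (g b) (ζ b).2 (p + 0)) := fun p => by
      rw [localMap_eq_model, add_zero, hhb, model_scaleSystem c hc0]
    rw [fderiv_equiv_comp_add h1, add_zero]
    set w := fderiv ℂ (localMap A (g b) (ζ b).2) ((ζ b).1, 0) u
    change ‖diagScale c hc0 w‖ = ‖w‖
    have h2 := mul_norm_le_norm_diagScale c hc0 zero_le_one (fun i => (hc1 i).ge) w
    have h3 := norm_diagScale_le c hc0 zero_le_one (fun i => (hc1 i).le) w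
    linarith
  have hna : ‖ha‖ ≤ 1 := norm_unitSystem_le _
  have hnb : ‖hb'‖ ≤ 1 := by
    refine (pi_norm_le_iff_of_nonneg zero_le_one).2 fun i => ?_
    rw [hhb, scaleSystem, norm_smul, hc1, one_mul]
    exact (norm_le_pi_norm _ i).trans (norm_unitSystem_le _)
  have hpt : ∀ τ ∈ Icc a b, ‖(((ζ τ).1, 0) : Coord l m)‖ ≤ 1 := fun τ hτ => by
    rw [Prod.norm_mk, norm_zero]
    exact max_le (hX τ hτ) zero_le_one
  have ham : a ∈ Icc a b := left_mem_Icc.2 hab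
  have hbm : b ∈ Icc a b := right_mem_Icc.2 hab
  have hgain : pathGain A g ζ a - pathGain A g ζ b ≤
      K ^ 3 * (‖hb' - ha‖ + omegaSeminorm A (ζ b - ζ a)) := by
    have h1 := hA.leastGain_sub_le (fun u => hb.lipschitz ha hb' ((ζ a).1, 0) ((ζ b).1, 0) u
      hna hnb (hpt a ham) (hpt b hbm))
    have h2 : omegaSeminorm A (((ζ a).1, 0) - ((ζ b).1, 0) : Coord l m) ≤
        K ^ 2 * omegaSeminorm A (ζ b - ζ a) := by
      refine (hb.omega_le _).trans ?_
      have h3 : ‖(((ζ a).1, 0) - ((ζ b).1, 0) : Coord l m)‖ ≤ ‖ζ b - ζ a‖ := by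
        rw [norm_sub_rev, Prod.mk_sub_mk, Prod.norm_mk, sub_zero, norm_zero]
        exact max_le (norm_fst_le (ζ b - ζ a)) (norm_nonneg _)
      have h4 := hb.norm_le (ζ b - ζ a)
      calc _ ≤ K * (K * omegaSeminorm A (ζ b - ζ a)) := by gcongr; exact h3.trans h4
        _ = _ := by ring
    have h3 : pathGain A g ζ a = leastGain A (fderiv ℂ (model A ha) ((ζ a).1, 0)) := by
      rw [pathGain, fderiv_localMap]
    rw [h3]
    have h4 := norm_nonneg (hb' - ha)
    have h5 : (1 : ℝ) ≤ K ^ 2 := one_le_pow₀ hK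
    rw [norm_sub_rev ha hb'] at h1
    have h6 : K * (‖hb' - ha‖ + omegaSeminorm A (((ζ a).1, 0) - ((ζ b).1, 0) : Coord l m)) ≤
        K * (K ^ 2 * ‖hb' - ha‖ + K ^ 2 * omegaSeminorm A (ζ b - ζ a)) := by
      gcongr
      nlinarith
    have h7 : K * (K ^ 2 * ‖hb' - ha‖ + K ^ 2 * omegaSeminorm A (ζ b - ζ a)) =
        K ^ 3 * (‖hb' - ha‖ + omegaSeminorm A (ζ b - ζ a)) := by ring
    linarith
  refine (ENNReal.ofReal_le_ofReal hgain).trans ?_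
  rw [ENNReal.ofReal_mul (by positivity)]
  gcongr
  rw [ENNReal.ofReal_add (norm_nonneg _) (apply_nonneg _ _)]
  refine le_trans (add_le_add ?_ (ofReal_omegaSeminorm_sub_le hab hζ))
    (le_lintegral_add _ _)
  have hi : ∀ i, ENNReal.ofReal ‖(hb' - ha) i‖ ≤
      ∫⁻ τ in Icc a b, ENNReal.ofReal (renormSpeed A g (fun s => (ζ s).2) τ) := fun i => by
    rw [ofReal_norm]
    refine (hc2 i).trans (lintegral_mono fun τ => ?_)
    simp only [← ofReal_norm]
    refine ENNReal.ofReal_le_ofReal (Real.le_sqrt_of_sq_le ?_)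
    exact Finset.single_le_sum (f := fun i => ‖projTangent (renorm (g τ) (ζ τ).2 i)
      (deriv (fun s => renorm (g s) (ζ s).2 i) τ)‖ ^ 2) (fun _ _ => by positivity)
      (Finset.mem_univ i)
  set I := ∫⁻ τ in Icc a b, ENNReal.ofReal (renormSpeed A g (fun s => (ζ s).2) τ)
  rcases eq_or_ne I ⊤ with hI | hI
  · rw [hI]; exact le_top
  · rw [ENNReal.ofReal_le_iff_le_toReal hI]
    refine (pi_norm_le_iff_of_nonneg ENNReal.toReal_nonneg).2 fun i => ?_
    exact (ENNReal.ofReal_le_iff_le_toReal hI).1 (hi i)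

end

section

variable {l m : ℕ} {A : Supports l m}

/-! ### One step of the homotopy -/

theorem IsApprox.mono {α α' : ℝ} {f : System A} {ybar : Fin m → ℂ} {X : Fin l → ℂ}
    (h : IsApprox A α' f ybar X) (hα : α' ≤ α) : IsApprox A α f ybar X :=
  ⟨h.pos, h.le.trans (mul_le_mul_of_nonneg_right hα h.pos.le)⟩

theorem model_eq_zero_of_localMap {f : System A} (hf : ∀ i, f i ≠ 0) {ybar : Fin m → ℂ}
    {z : Coord l m} (h : localMap A f ybar z = 0) : model A f ((0, ybar) + z) = 0 := by
  obtain ⟨S, hS⟩ := exists_localMap_eq_model hf ybar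
  rw [hS z] at h
  rw [add_comm (0, ybar) z]
  exact (map_eq_zero_iff S S.injective).1 h

namespace IsRegularityBound

variable {K δ : ℝ} (hb : IsRegularityBound A K δ) (hA : LocallyNondegenerate A) {α : ℝ}
  (hα : 0 < α) (hαs : α ≤ δ / (4096 * K ^ 2))

include hb hA hα hαs

/-- Estimates for the associated zero. -/
theorem associatedZero_estimates {f : System A} (hf : ∀ i, f i ≠ 0) {ybar : Fin m → ℂ}
    {X : Fin l → ℂ} (hX : ∀ k, ‖X k‖ ≤ 1 / 4) (h : IsApprox A α f ybar X) {z : Coord l m}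
    (hz : IsAssociatedZero A f ybar X z) :
    omegaSeminorm A (z - (X, 0)) ≤ 2 * omegaSeminorm A
        ((fderiv ℂ (localMap A f ybar) (X, 0)).inverse (localMap A f ybar (X, 0))) ∧
      leastGain A (fderiv ℂ (localMap A f (ybar + z.2)) (z.1, 0)) ≤
        4 * leastGain A (fderiv ℂ (localMap A f ybar) (X, 0)) ∧
      leastGain A (fderiv ℂ (localMap A f ybar) (X, 0)) ≤
        4 * leastGain A (fderiv ℂ (localMap A f (ybar + z.2)) (z.1, 0)) := by
  obtain ⟨z', hz', h1⟩ := hb.exists_associatedZero hA hα hαs hf hX h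
  rwa [tendsto_nhds_unique hz.tendsto hz'.tendsto]

theorem associatedZero_le {f : System A} (hf : ∀ i, f i ≠ 0) {ybar : Fin m → ℂ}
    {X : Fin l → ℂ} (hX : ∀ k, ‖X k‖ ≤ 1 / 4) (h : IsApprox A α f ybar X) {z : Coord l m}
    (hz : IsAssociatedZero A f ybar X z) :
    omegaSeminorm A (z - (X, 0)) ≤
      2 * (α * leastGain A (fderiv ℂ (localMap A f ybar) (X, 0))) :=
  (hb.associatedZero_estimates hA hα hαs hf hX h hz).1.trans (by linarith [h.le])

/-- The associated zero depends continuously on time. -/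
theorem continuousOn_associatedZero {g : ℝ → System A} {s : Set ℝ} (hg : ContinuousOn g s)
    (hg0 : ∀ τ ∈ s, ∀ i, g τ i ≠ 0) {ybar : Fin m → ℂ} {X : Fin l → ℂ} (hX : ∀ k, ‖X k‖ ≤ 1 / 4)
    (h : ∀ τ ∈ s, IsApprox A α (g τ) ybar X) {z : ℝ → Coord l m}
    (hz : ∀ τ ∈ s, IsAssociatedZero A (g τ) ybar X (z τ)) : ContinuousOn z s := by
  intro τ₀ hτ₀
  have hK := hb.one_le
  have hα1 := (hb.alpha_bounds hα hαs).1
  set κ : ℝ → ℝ := fun τ => leastGain A (fderiv ℂ (localMap A (g τ) ybar) (X, 0)) with hκ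
  have hκc : ContinuousWithinAt κ s τ₀ :=
    hA.continuous_leastGain.continuousAt.comp_continuousWithinAt
      (continuousOn_fderiv_localMap hg hg0 (y := fun _ => ybar) (p := fun _ => (X, 0))
        continuousOn_const continuousOn_const τ₀ hτ₀)
  have hQc : ContinuousWithinAt (fun τ => localMap A (g τ) ybar (z τ₀)) s τ₀ :=
    continuousOn_localMap hg hg0 (y := fun _ => ybar) (p := fun _ => z τ₀)
      continuousOn_const continuousOn_const τ₀ hτ₀
  have hpos : 0 < κ τ₀ := (h τ₀ hτ₀).pos
  have hle : ∀ τ ∈ s, omegaSeminorm A (z τ - (X, 0)) ≤ 2 * (α * κ τ) := fun τ hτ =>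
    hb.associatedZero_le hA hα hαs (hg0 τ hτ) hX (h τ hτ) (hz τ hτ)
  have hlt : ∀ᶠ τ in 𝓝[s] τ₀, κ τ₀ / 2 < κ τ := hκc.eventually_const_lt (by linarith)
  have hlim : Tendsto (fun τ => K * (4 / κ τ₀ * ‖localMap A (g τ) ybar (z τ₀)‖)) (𝓝[s] τ₀) (𝓝 0) := by
    have h1 := (hQc.norm.tendsto.const_mul (4 / κ τ₀)).const_mul K
    rw [(hz τ₀ hτ₀).isZero] at h1
    simpa using h1
  rw [ContinuousWithinAt, tendsto_iff_norm_sub_tendsto_zero]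
  refine squeeze_zero' (Eventually.of_forall fun τ => norm_nonneg _) ?_ hlim
  filter_upwards [hlt, self_mem_nhdsWithin] with τ h1 hτ
  refine (hb.norm_le _).trans ?_
  gcongr
  have h2 := hle τ hτ
  have h3 := hle τ₀ hτ₀
  have hD : ∀ τ ∈ s, z τ ∈ Metric.closedBall (0 : Coord l m) 1 := fun τ hτ =>
    mem_closedBall_zero_iff.2 ((hb.norm_sub_le_of_omegaSeminorm_le hA hα hαs hX (hle τ hτ)).2.trans (by norm_num))
  have hx : ((X, 0) : Coord l m) ∈ Metric.closedBall (0 : Coord l m) 1 := by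
    have h4 := hb.norm_sub_le_of_omegaSeminorm_le hA hα hαs hX (f := g τ) (ybar := ybar)
      (p := ((X, 0) : Coord l m)) (by simpa using mul_nonneg hα.le (h τ hτ).pos.le)
    exact mem_closedBall_zero_iff.2 (h4.2.trans (by norm_num))
  have h5 := lowerBound_mul_le_norm_sub (differentiable_localMap A (g τ) ybar)
    (by linarith) (convex_closedBall 0 1) (hb.derivLipschitzOn (g τ) ybar) (hD τ₀ hτ₀) (hD τ hτ) hx
    (r := 4 * (α * κ τ)) (h3.trans (by nlinarith)) (h2.trans (by nlinarith [(h τ hτ).pos]))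
    (leastGain_mul_le A _)
  rw [(hz τ hτ).isZero, zero_sub, norm_neg] at h5
  change (κ τ - K * (4 * (α * κ τ))) * _ ≤ _ at h5
  have h6 : κ τ₀ / 4 ≤ κ τ - K * (4 * (α * κ τ)) := by
    have : K * (4 * (α * κ τ)) ≤ κ τ / 4 := by
      have := (h τ hτ).pos
      change 0 < κ τ at this
      nlinarith
    linarith
  have h7 := (mul_le_mul_of_nonneg_right h6
    (apply_nonneg (omegaSeminorm A) (z τ - z τ₀))).trans h5
  rw [div_mul_eq_mul_div, le_div_iff₀ hpos]
  linarith

/-- Where the path of zeros comes from approximate zeros it is `C^1` in the interior. -/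
theorem contDiffAt_zeros {g : ℝ → System A} {ζ : ℝ → Coord l m} {a b : ℝ}
    (hg : ∀ τ ∈ Ioo a b, ContDiffAt ℝ 1 g τ)
    (hg0 : ∀ τ ∈ Ioo a b, ∀ i, g τ i ≠ 0) {ybar : Fin m → ℂ} {X : Fin l → ℂ}
    (hX : ∀ k, ‖X k‖ ≤ 1 / 4)
    (h : ∀ τ ∈ Ioo a b, IsApprox A α (g τ) ybar X)
    (hz : ∀ τ ∈ Ioo a b, IsAssociatedZero A (g τ) ybar X (ζ τ - (0, ybar))) :
    ∀ τ ∈ Ioo a b, ContDiffAt ℝ 1 ζ τ := by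
  intro τ hτ
  have hgc : ContinuousOn g (Ioo a b) := fun τ hτ => (hg τ hτ).continuousAt.continuousWithinAt
  have hζc : ContinuousOn ζ (Ioo a b) := by
    have := (hb.continuousOn_associatedZero hA hα hαs hgc hg0 hX h hz).add
      (continuousOn_const (c := ((0, ybar) : Coord l m)))
    exact this.congr fun τ _ => (sub_add_cancel (ζ τ) (0, ybar)).symm
  have hnhds : Ioo a b ∈ 𝓝 τ := Ioo_mem_nhds hτ.1 hτ.2
  refine contDiffAt_of_model_eq_zero (hg τ hτ) (hζc.continuousAt hnhds) ?_ ?_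
  · filter_upwards [hnhds] with t ht
    have := model_eq_zero_of_localMap (hg0 t ht) (hz t ht).isZero
    rwa [add_sub_cancel] at this
  · have h1 := (hb.associatedZero_estimates hA hα hαs (hg0 τ hτ) hX (h τ hτ) (hz τ hτ)).2.2
    have h2 := (h τ hτ).pos
    have h3 : ybar + (ζ τ - (0, ybar)).2 = (ζ τ).2 := by simp
    have h4 : (ζ τ - (0, ybar)).1 = (ζ τ).1 := by simp
    rw [h3, h4] at h1
    have h5 := hA.isInvertible_of_leastGain_pos (by linarith :
      0 < leastGain A (fderiv ℂ (localMap A (g τ) (ζ τ).2) ((ζ τ).1, 0)))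
    obtain ⟨S, hS⟩ := exists_localMap_eq_model (hg0 τ hτ) (ζ τ).2
    rw [fderiv_equiv_comp_add hS, ContinuousLinearMap.isInvertible_equiv_comp] at h5
    have h6 : ((ζ τ).1, 0) + (0, (ζ τ).2) = ζ τ := by ext <;> simp
    rwa [h6] at h5

end IsRegularityBound

theorem step_length_bound {α K P k : ℝ} (hα : 0 < α) (hP : 0 ≤ P) (hPk : P ≤ 4 * k)
    (hK : 1 ≤ K ^ 3) : 2 * P * (α / (64 * K ^ 3)) ≤ α / 8 * k := by
  have h6 : α / (64 * K ^ 3) ≤ α / 64 := by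
    apply div_le_div_of_nonneg_left hα.le (by norm_num); linarith
  calc 2 * P * (α / (64 * K ^ 3)) ≤ 2 * (4 * k) * (α / 64) :=
        mul_le_mul (by linarith) h6 (by positivity) (by linarith)
    _ = α / 8 * k := by ring

theorem mul_quarter_le {α K k : ℝ} (h : 4096 * K * α ≤ 1) (hk : 0 ≤ k) :
    K * (α / 4 * k) ≤ k := by
  calc K * (α / 4 * k) = (4096 * K * α) * (k / 16384) := by ring
    _ ≤ 1 * (k / 16384) := by gcongr
    _ ≤ k := by linarith

/-- The data of the homotopy on a time interval on which the renormalization point and the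
approximate zero stay fixed. -/
structure IsStep (A : Supports l m) (α T : ℝ) (g : ℝ → System A) (ybar : Fin m → ℂ)
    (X : Fin l → ℂ) (ζ : ℝ → Coord l m) (s : Set ℝ) : Prop where
  contDiffOn : ContDiffOn ℝ 1 g (Icc 0 T)
  ne_zero : ∀ τ ∈ Icc 0 T, ∀ i, g τ i ≠ 0
  subset : s ⊆ Icc 0 T
  norm_le : ∀ k, ‖X k‖ ≤ 1 / 4
  approx : ∀ τ ∈ s, IsApprox A α (g τ) ybar X
  zero : ∀ τ ∈ s, IsAssociatedZero A (g τ) ybar X (ζ τ - (0, ybar))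

namespace IsStep

variable {K δ : ℝ} {α T : ℝ} {g : ℝ → System A} {ybar : Fin m → ℂ}
    {X : Fin l → ℂ} {ζ : ℝ → Coord l m} {s : Set ℝ} (H : IsStep A α T g ybar X ζ s)
    (hb : IsRegularityBound A K δ) (hA : LocallyNondegenerate A)
    (hα : 0 < α) (hαs : α ≤ δ / (4096 * K ^ 2))

include H

theorem mono {s' : Set ℝ} (h : s' ⊆ s) : IsStep A α T g ybar X ζ s' :=
  ⟨H.contDiffOn, H.ne_zero, h.trans H.subset, H.norm_le, fun τ hτ => H.approx τ (h hτ),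
    fun τ hτ => H.zero τ (h hτ)⟩

include hb hA hα hαs

theorem estimates {τ : ℝ} (hτ : τ ∈ s) :
    omegaSeminorm A (ζ τ - (0, ybar) - (X, 0)) ≤ 2 * omegaSeminorm A
        ((fderiv ℂ (localMap A (g τ) ybar) (X, 0)).inverse (localMap A (g τ) ybar (X, 0))) ∧
      pathGain A g ζ τ ≤ 4 * leastGain A (fderiv ℂ (localMap A (g τ) ybar) (X, 0)) ∧
      leastGain A (fderiv ℂ (localMap A (g τ) ybar) (X, 0)) ≤ 4 * pathGain A g ζ τ := by
  have h := hb.associatedZero_estimates hA hα hαs (H.ne_zero τ (H.subset hτ)) H.norm_le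
    (H.approx τ hτ) (H.zero τ hτ)
  have h3 : ybar + (ζ τ - (0, ybar)).2 = (ζ τ).2 := by simp
  have h4 : (ζ τ - (0, ybar)).1 = (ζ τ).1 := by simp
  rwa [h3, h4] at h

theorem pathGain_pos {τ : ℝ} (hτ : τ ∈ s) : 0 < pathGain A g ζ τ := by
  have h1 := (H.estimates hb hA hα hαs hτ).2.2
  have h2 := (H.approx τ hτ).pos
  linarith

theorem norm_sub_le_half {τ : ℝ} (hτ : τ ∈ s) : ‖ζ τ - (0, ybar)‖ ≤ 1 / 2 :=
  (hb.norm_sub_le_of_omegaSeminorm_le hA hα hαs H.norm_le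
    (hb.associatedZero_le hA hα hαs (H.ne_zero τ (H.subset hτ)) H.norm_le (H.approx τ hτ)
      (H.zero τ hτ))).2

theorem continuousOn : ContinuousOn ζ s := by
  have := (hb.continuousOn_associatedZero hA hα hαs (H.contDiffOn.continuousOn.mono H.subset)
    (fun τ hτ => H.ne_zero τ (H.subset hτ)) H.norm_le H.approx H.zero).add
      (continuousOn_const (c := ((0, ybar) : Coord l m)))
  exact this.congr fun τ _ => (sub_add_cancel (ζ τ) (0, ybar)).symm

theorem continuousOn_pathGain : ContinuousOn (pathGain A g ζ) s := by
  have h := H.continuousOn hb hA hα hαs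
  exact hA.continuous_leastGain.comp_continuousOn
    (continuousOn_fderiv_localMap (H.contDiffOn.continuousOn.mono H.subset)
      (fun τ hτ => H.ne_zero τ (H.subset hτ)) h.snd (h.fst.prodMk continuousOn_const))

/-- The bounds on the variation of the zero and of the least gain, inside the interval. -/
theorem variation {a b : ℝ} (hs : Ioo a b ⊆ s) {t t' : ℝ} (hat : a < t) (htt : t ≤ t')
    (htb : t' < b) :
    ENNReal.ofReal (pathGain A g ζ t - pathGain A g ζ t') ≤
        ENNReal.ofReal (K ^ 3) * ∫⁻ τ in Icc t t', pathSpeed A g ζ τ ∧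
      ENNReal.ofReal (omegaSeminorm A (ζ t' - ζ t)) ≤
        1 * ∫⁻ τ in Icc t t', pathSpeed A g ζ τ := by
  have H' := H.mono hs
  have hsub : Icc t t' ⊆ Ioo a b := fun τ hτ => ⟨hat.trans_le hτ.1, hτ.2.trans_lt htb⟩
  have hg : ∀ τ ∈ Ioo a b, ContDiffAt ℝ 1 g τ := fun τ hτ =>
    H.contDiffOn.contDiffAt (mem_of_superset (Ioo_mem_nhds hτ.1 hτ.2) H'.subset)
  have hζ := hb.contDiffAt_zeros hA hα hαs hg (fun τ hτ => H.ne_zero τ (H'.subset hτ)) H.norm_le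
    H'.approx H'.zero
  constructor
  · refine hb.ofReal_pathGain_sub_le hA htt (fun τ hτ => hg τ (hsub hτ))
      (fun τ hτ => H.ne_zero τ (H'.subset (hsub hτ))) (fun τ hτ => hζ τ (hsub hτ)) fun τ hτ => ?_
    have h1 := (norm_fst_le (ζ τ - (0, ybar))).trans
      (H'.norm_sub_le_half hb hA hα hαs (hsub hτ))
    have h2 : (ζ τ - (0, ybar)).1 = (ζ τ).1 := by simp
    rw [h2] at h1
    linarith
  · rw [one_mul]
    refine (ofReal_omegaSeminorm_sub_le htt fun τ hτ => hζ τ (hsub hτ)).trans ?_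
    exact lintegral_mono fun τ => le_add_self

/-- If the condition length up to `b` is finite, then the approximate zero survives to `b`:
otherwise the condition number would tend to infinity, along a path of infinite length. -/
theorem isApprox_right {a b : ℝ} (hab : a < b) (hs : Ico a b ⊆ s) (hbT : b ≤ T)
    (hfin : ∫⁻ τ in Icc a b, pathSpeed A g ζ τ * (ENNReal.ofReal (pathGain A g ζ τ))⁻¹ ≠ ⊤) :
    IsApprox A α (g b) ybar X := by
  have hK := hb.one_le
  have H' := H.mono hs
  have ha0 : 0 ≤ a := (H'.subset (left_mem_Ico.2 hab)).1
  set F : ℝ → ℝ≥0∞ := fun τ => pathSpeed A g ζ τ * (ENNReal.ofReal (pathGain A g ζ τ))⁻¹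
  have hε : 0 < 1 / (4 * K ^ 3) := by positivity
  -- the condition length of a short final segment is small
  obtain ⟨a', ha', hint⟩ : ∃ a' ∈ Ioo a b,
      ∫⁻ τ in Icc a' b, F τ ≤ ENNReal.ofReal (1 / (4 * K ^ 3)) := by
    have h1 : Tendsto (fun a' => (volume.restrict (Icc a b)) (Icc a' b)) (𝓝[<] b) (𝓝 0) := by
      have h2 : Tendsto (fun a' => ENNReal.ofReal (b - a')) (𝓝[<] b) (𝓝 0) := by
        have : Continuous fun a' : ℝ => ENNReal.ofReal (b - a') :=
          ENNReal.continuous_ofReal.comp (by fun_prop)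
        simpa using (this.tendsto b).mono_left nhdsWithin_le_nhds
      refine tendsto_of_tendsto_of_tendsto_of_le_of_le tendsto_const_nhds h2
        (fun _ => zero_le) fun a' => ?_
      exact (Measure.restrict_apply_le _ _).trans (by rw [Real.volume_Icc])
    have h2 := tendsto_setLIntegral_zero hfin h1
    have h3 := h2.eventually_le_const (u := ENNReal.ofReal (1 / (4 * K ^ 3)))
      (ENNReal.ofReal_pos.2 hε)
    obtain ⟨a', h4, h5⟩ := (h3.and (Ioo_mem_nhdsLT hab)).exists
    refine ⟨a', h5, ?_⟩
    rwa [Measure.restrict_restrict measurableSet_Icc,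
      inter_eq_left.2 (Icc_subset_Icc_left h5.1.le)] at h4
  have ha's : a' ∈ Ico a b := ⟨ha'.1.le, ha'.2⟩
  have hpos := H'.pathGain_pos hb hA hα hαs ha's
  refine hA.isApprox_of_frequently H.contDiffOn.continuousOn H.ne_zero
    (show b ∈ Icc 0 T from ⟨by linarith, hbT⟩) (c := pathGain A g ζ a' / 8) (by linarith) ?_
  have hne : (𝓝[Ioo a' b] b).NeBot := right_nhdsWithin_Ioo_neBot ha'.2
  have hsubT : Ioo a' b ⊆ Icc 0 T := fun τ hτ =>
    ⟨by linarith [hτ.1, ha'.1], by linarith [hτ.2]⟩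
  refine Frequently.filter_mono ?_ (nhdsWithin_mono b hsubT)
  refine Eventually.frequently ?_
  filter_upwards [self_mem_nhdsWithin] with τ hτ
  have hτs : τ ∈ Ico a b := ⟨(ha'.1.trans hτ.1).le, hτ.2⟩
  refine ⟨H'.approx τ hτs, ?_⟩
  have hsub : Icc a' τ ⊆ Ico a b := fun x hx => ⟨ha'.1.le.trans hx.1, hx.2.trans_lt hτ.2⟩
  have h1 := (le_two_mul_of_lintegral_le (κ := pathGain A g ζ) (w := pathSpeed A g ζ)
    (a := a') (b := τ) (L := K ^ 3) (ε := 1 / (4 * K ^ 3))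
    ((H'.continuousOn_pathGain hb hA hα hαs).mono hsub) (by positivity) hε.le
    (by field_simp; norm_num)
    (fun x x' h1 h2 h3 => (H'.variation hb hA hα hαs (a := a') (b := τ)
      (Ioo_subset_Icc_self.trans hsub) h1 h2 h3).1)
    ((lintegral_mono_set (Icc_subset_Icc_right hτ.2.le)).trans hint)
    (H'.pathGain_pos hb hA hα hαs hτs)).1 a' (left_mem_Icc.2 hτ.1.le)
  have h2 := (H'.estimates hb hA hα hαs hτs).2.1
  linarith

/-- A step with small initial `β μ` and small condition length ends with `β μ ≤ α / 2`. -/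
theorem isApprox_half {a b : ℝ} (hab : a ≤ b) (hs : Icc a b ⊆ s)
    (ha : IsApprox A (α / 512) (g a) ybar X)
    (hint : ∫⁻ τ in Icc a b, pathSpeed A g ζ τ * (ENNReal.ofReal (pathGain A g ζ τ))⁻¹ ≤
      ENNReal.ofReal (α / (64 * K ^ 3))) :
    IsApprox A (α / 2) (g b) ybar X := by
  rcases hab.eq_or_lt with rfl | hlt
  · exact ha.mono (by linarith)
  have hK := hb.one_le
  have hα1 := (hb.alpha_bounds hα hαs).1
  have H' := H.mono hs
  have ham : a ∈ Icc a b := left_mem_Icc.2 hab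
  have hbm : b ∈ Icc a b := right_mem_Icc.2 hab
  have hK3 : 1 ≤ K ^ 3 := one_le_pow₀ hK
  have hgc := H'.continuousOn_pathGain hb hA hα hαs
  have hζc := H'.continuousOn hb hA hα hαs
  have hvar := fun t t' => H'.variation hb hA hα hαs (a := a) (b := b) Ioo_subset_Icc_self
    (t := t) (t' := t')
  obtain ⟨h1, h2⟩ := le_two_mul_of_lintegral_le (κ := pathGain A g ζ) (w := pathSpeed A g ζ)
    (a := a) (b := b) (L := K ^ 3) (ε := α / (64 * K ^ 3)) hgc (by positivity) (by positivity)
    (by field_simp; nlinarith)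
    (fun t t' h1 h2 h3 => (hvar t t' h1 h2 h3).1) hint (H'.pathGain_pos hb hA hα hαs hbm)
  have h3 := ofReal_le_lintegral_Icc_of_Ioo (φ := fun t t' => omegaSeminorm A (ζ t' - ζ t))
    (w := pathSpeed A g ζ) (L := 1)
    ((continuous_omegaSeminorm A).comp_continuousOn
      ((hζc.comp continuousOn_snd fun x hx => hx.2).sub
        (hζc.comp continuousOn_fst fun x hx => hx.1)))
    (fun t t' h1 h2 h3 => (hvar t t' h1 h2 h3).2) le_rfl hlt le_rfl
  rw [one_mul] at h3
  have h4 := h3.trans h2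
  have hgb := H'.pathGain_pos hb hA hα hαs hbm
  rw [ENNReal.ofReal_le_ofReal_iff (by positivity)] at h4
  set k := leastGain A (fderiv ℂ (localMap A (g b) ybar) (X, 0)) with hk
  have hk0 : 0 < k := (H'.approx b hbm).pos
  obtain ⟨-, eb, -⟩ := H'.estimates hb hA hα hαs hbm
  obtain ⟨ea1, -, ea2⟩ := H'.estimates hb hA hα hαs ham
  have h5 : omegaSeminorm A (ζ b - ζ a) ≤ α / 8 * k := by
    refine h4.trans ?_
    exact step_length_bound hα hgb.le eb hK3
  have h6 : omegaSeminorm A (ζ a - (0, ybar) - (X, 0)) ≤ α / 8 * k := by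
    refine ea1.trans ?_
    have h7 := ha.le
    have h8 := h1 a ham
    have h9 : leastGain A (fderiv ℂ (localMap A (g a) ybar) (X, 0)) ≤ 32 * k := by linarith
    have h10 := mul_le_mul_of_nonneg_left h9 (show 0 ≤ α / 512 by positivity)
    linarith
  have h7 : omegaSeminorm A (ζ b - (0, ybar) - (X, 0)) ≤ α / 4 * k := by
    have h8 := map_add_le_add (omegaSeminorm A) (ζ b - ζ a) (ζ a - (0, ybar) - (X, 0))
    have h9 : ζ b - ζ a + (ζ a - (0, ybar) - (X, 0)) = ζ b - (0, ybar) - (X, 0) := by abel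
    rw [h9] at h8
    linarith
  have hαk : 0 < α * k := mul_pos hα hk0
  have hKN : K * omegaSeminorm A (ζ b - (0, ybar) - (X, 0)) ≤ k := by
    exact (mul_le_mul_of_nonneg_left h7 (zero_le_one.trans hK)).trans
      (mul_quarter_le hα1 hk0.le)
  have hz := (hb.norm_sub_le_of_omegaSeminorm_le hA hα hαs H.norm_le (f := g b) (ybar := ybar)
    (p := ζ b - (0, ybar)) (h7.trans (by linarith))).2
  have hx := (hb.norm_sub_le_of_omegaSeminorm_le hA hα hαs H.norm_le (f := g b) (ybar := ybar)
    (p := ((X, 0) : Coord l m)) (by simpa using hαk.le)).2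
  have h8 := apply_newton_correction_le (differentiable_localMap A (g b) ybar) (by linarith)
    (convex_closedBall 0 1) (hb.derivLipschitzOn (g b) ybar)
    (mem_closedBall_zero_iff.2 (hx.trans (by norm_num)))
    (mem_closedBall_zero_iff.2 (hz.trans (by norm_num))) (H'.zero b hbm).isZero hk0
    (leastGain_mul_le A _) (hA.isInvertible_of_leastGain_pos hk0) hKN
  exact ⟨hk0, by linarith⟩

end IsStep

end

section

variable {l m : ℕ} {A : Supports l m}

/-! ### The homotopy -/

theorem zeroPath_eq_of_tendsto {g : ℝ → System A} {t : ℕ → ℝ} {X : ℕ → Fin l → ℂ}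
    {y : ℕ → Fin m → ℂ} {τ : ℝ} {j : ℕ} {z : Coord l m} (hj : sInf {j : ℕ | τ ≤ t j} = j)
    (h : Tendsto (fun s : ℕ => (newton (localMap A (g τ) (y j)))^[s] (X j, 0)) atTop (𝓝 z)) :
    zeroPath A g t X y τ = (0, y j) + z := by
  rw [zeroPath, hj, h.limUnder_eq]

namespace IsHomotopyRun

variable {c α T : ℝ} {g : ℝ → System A} {J : ℕ} {t : ℕ → ℝ} {X : ℕ → Fin l → ℂ}
  {y : ℕ → Fin m → ℂ} (R : IsHomotopyRun A c α T g J t X y) (hT : 0 ≤ T)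

include R

theorem le_of_mem {j : ℕ} (htj : t j ≤ T) {τ : ℝ}
    (hτ : τ ∈ insert T {τ | t j < τ ∧ τ ≤ T ∧
      ENNReal.ofReal α < ENNReal.ofReal c *
        beta A (g τ) (y (j + 1)) (X (j + 1)) * mu A (g τ) (y (j + 1)) (X (j + 1))}) :
    t j ≤ τ := by
  rcases hτ with rfl | h
  · exact htj
  · exact h.1.le

theorem time_succ {j : ℕ} (hj : j < J) (htj : t j ≤ T) : t j ≤ t (j + 1) ∧ t (j + 1) ≤ T := by
  rw [R.step j hj]
  exact ⟨le_csInf (insert_nonempty _ _) fun τ hτ => R.le_of_mem htj hτ,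
    csInf_le ⟨t j, fun τ hτ => R.le_of_mem htj hτ⟩ (mem_insert _ _)⟩

/-- Every positive time up to the last one lies in a step. -/
theorem exists_mem_step {τ : ℝ} {n : ℕ} (hn : n ≤ J) (hτ : τ ∈ Icc 0 (t n)) :
    τ = 0 ∨ ∃ j < n, τ ∈ Icc (t j) (t (j + 1)) := by
  induction n with
  | zero =>
    rw [R.start] at hτ
    exact Or.inl (le_antisymm hτ.2 hτ.1)
  | succ n ih =>
    rcases le_total τ (t n) with h | h
    · rcases ih (by omega) ⟨hτ.1, h⟩ with h1 | ⟨j, hj, h1⟩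
      · exact Or.inl h1
      · exact Or.inr ⟨j, by omega, h1⟩
    · exact Or.inr ⟨n, by omega, h, hτ.2⟩

include hT

theorem time_le {j : ℕ} (hj : j ≤ J) : t j ≤ T := by
  induction j with
  | zero => rw [R.start]; exact hT
  | succ j ih => exact (R.time_succ hj (ih (by omega))).2

theorem time_mono {i j : ℕ} (hij : i ≤ j) (hj : j ≤ J) : t i ≤ t j := by
  induction j, hij using Nat.le_induction with
  | base => exact le_rfl
  | succ j hij ih =>
    exact (ih (by omega)).trans (R.time_succ hj (R.time_le hT (by omega))).1

theorem time_nonneg {j : ℕ} (hj : j ≤ J) : 0 ≤ t j := by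
  rw [← R.start]
  exact R.time_mono hT (Nat.zero_le j) hj

/-- Inside a step the path of zeros is computed from the end point of the step. -/
theorem sInf_eq {j : ℕ} (hj : j < J) {τ : ℝ} (hτ : τ ∈ Ioc (t j) (t (j + 1))) :
    sInf {j : ℕ | τ ≤ t j} = j + 1 := by
  apply le_antisymm
  · exact Nat.sInf_le hτ.2
  · refine le_csInf ⟨j + 1, hτ.2⟩ fun i hi => ?_
    by_contra! h
    have h1 := R.time_mono hT (show i ≤ j by omega) hj.le
    have h2 : τ ≤ t i := hi
    linarith [hτ.1]

theorem continuousOn_of_steps {V : Type*} [TopologicalSpace V] {ζ : ℝ → V} {n : ℕ} (hn : n ≤ J)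
    (h : ∀ j < n, ContinuousOn ζ (Icc (t j) (t (j + 1)))) : ContinuousOn ζ (Icc 0 (t n)) := by
  induction n with
  | zero => rw [R.start, Icc_self]; exact continuousOn_singleton _ _
  | succ n ih =>
    rw [← Icc_union_Icc_eq_Icc (R.time_nonneg hT (show n ≤ J by omega))
      (R.time_mono hT n.le_succ hn)]
    exact (ih (by omega) fun j hj => h j (by omega)).union_of_isClosed (h n (by omega))
      isClosed_Icc isClosed_Icc

theorem mul_le_lintegral_of_steps {F : ℝ → ℝ≥0∞} {ε : ℝ≥0∞} {n : ℕ} (hn : n ≤ J)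
    (h : ∀ j < n, ε ≤ ∫⁻ τ in Icc (t j) (t (j + 1)), F τ) :
    n * ε ≤ ∫⁻ τ in Icc 0 (t n), F τ := by
  induction n with
  | zero => simp
  | succ n ih =>
    rw [← Icc_union_Ioc_eq_Icc (R.time_nonneg hT (show n ≤ J by omega))
      (R.time_mono hT n.le_succ hn), lintegral_union measurableSet_Ioc, Nat.cast_succ, add_mul,
      one_mul, setLIntegral_congr (Ioc_ae_eq_Icc (a := t n))]
    · exact add_le_add (ih (by omega) fun j hj => h j (by omega)) (h n (by omega))
    · rw [Set.disjoint_left]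
      exact fun x hx hx' => absurd hx.2 (not_le.2 hx'.1)

end IsHomotopyRun

section Run

variable {K δ : ℝ} (hb : IsRegularityBound A K δ) (hA : LocallyNondegenerate A) {α : ℝ}
  (hα : 0 < α) (hαs : α ≤ δ / (4096 * K ^ 2)) {T : ℝ} {g : ℝ → System A} (hT : 0 ≤ T)
  (hg : ContDiffOn ℝ 1 g (Icc 0 T)) (hg0 : ∀ τ ∈ Icc 0 T, ∀ i, g τ i ≠ 0)
  {J : ℕ} {t : ℕ → ℝ} {X : ℕ → Fin l → ℂ} {y : ℕ → Fin m → ℂ}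
  (R : IsHomotopyRun A 1 α T g J t X y)
  (hX : ∀ j ≤ J, ∀ k, ‖X j k‖ ≤ 1 / 4)

include hb hA hα hαs hT hg hg0 R hX

/-- The induction step: a valid approximate zero at time `t j` yields a step of the homotopy on
which the next approximate zero remains valid, end point included. -/
theorem isStep_of_run (hfin : renormLength A g (zeroPath A g t X y) 0 (t J) ≠ ⊤)
    {j : ℕ} (hj : j < J) (happ : IsApprox A α (g (t j)) (y j) (X j))
    (hzero : IsAssociatedZero A (g (t j)) (y j) (X j) (zeroPath A g t X y (t j) - (0, y j))) :
    IsStep A α T g (y (j + 1)) (X (j + 1)) (zeroPath A g t X y) (Icc (t j) (t (j + 1))) ∧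
      IsApprox A (α / 512) (g (t j)) (y (j + 1)) (X (j + 1)) := by
  set ζ := zeroPath A g t X y with hζ
  have ht0 := R.time_nonneg hT hj.le
  have htT := R.time_le hT hj.le
  obtain ⟨hle, hleT⟩ := R.time_succ hj htT
  have hmemT : ∀ τ ∈ Icc (t j) (t (j + 1)), τ ∈ Icc 0 T := fun τ hτ =>
    ⟨ht0.trans hτ.1, hτ.2.trans hleT⟩
  have hX' := hX (j + 1) hj
  obtain ⟨hnext, hshift⟩ := hb.isApprox_next hA hα hαs (hg0 (t j) ⟨ht0, htT⟩) (hX j hj.le) happ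
    (R.iterate j hj)
  have hassoc : ∀ τ ∈ Icc (t j) (t (j + 1)), IsApprox A α (g τ) (y (j + 1)) (X (j + 1)) →
      IsAssociatedZero A (g τ) (y (j + 1)) (X (j + 1)) (ζ τ - (0, y (j + 1))) := by
    intro τ hτ h
    obtain ⟨z, hz, -⟩ := hb.exists_associatedZero hA hα hαs (hg0 τ (hmemT τ hτ)) hX' h
    have hzζ : ζ τ = (0, y (j + 1)) + z := by
      rcases hτ.1.eq_or_lt with heq | hlt
      · -- at the beginning of the step the new Newton sequence is the tail of the old one
        subst heq
        have h1 : Tendsto (fun s => ((0, y (j + 1)) : Coord l m) +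
            (newton (localMap A (g (t j)) (y (j + 1))))^[s] (X (j + 1), 0)) atTop
            (𝓝 ((0, y (j + 1)) + z)) := hz.tendsto.const_add _
        have h2 : Tendsto (fun s => ((0, y j) : Coord l m) +
            (newton (localMap A (g (t j)) (y j)))^[s + 1] (X j, 0)) atTop
            (𝓝 ((0, y j) + (ζ (t j) - (0, y j)))) :=
          ((tendsto_add_atTop_iff_nat 1).2 hzero.tendsto).const_add _
        simp only [hshift] at h1
        rw [← tendsto_nhds_unique h2 h1]
        abel
      · exact zeroPath_eq_of_tendsto (R.sInf_eq hT hj ⟨hlt, hτ.2⟩) hz.tendsto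
    rw [hzζ, add_sub_cancel_left]
    exact hz
  have happIco : ∀ τ ∈ Ico (t j) (t (j + 1)), IsApprox A α (g τ) (y (j + 1)) (X (j + 1)) := by
    intro τ hτ
    rcases hτ.1.eq_or_lt with heq | hlt
    · subst heq
      exact hnext.mono (by linarith)
    · rw [← hA.beta_mul_mu_le_iff hα]
      by_contra! hcon
      have h1 : t (j + 1) ≤ τ := by
        rw [R.step j hj]
        exact csInf_le ⟨t j, fun x hx => R.le_of_mem htT hx⟩
          (mem_insert_of_mem _ ⟨hlt, (hτ.2.trans_le hleT).le, hcon⟩)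
      exact absurd hτ.2 (not_lt.2 h1)
  have hstep : IsStep A α T g (y (j + 1)) (X (j + 1)) ζ (Ico (t j) (t (j + 1))) :=
    ⟨hg, hg0, fun τ hτ => hmemT τ (Ico_subset_Icc_self hτ), hX', happIco, fun τ hτ =>
      hassoc τ (Ico_subset_Icc_self hτ) (happIco τ hτ)⟩
  have happ' : IsApprox A α (g (t (j + 1))) (y (j + 1)) (X (j + 1)) := by
    rcases hle.eq_or_lt with heq | hlt
    · rw [← heq]
      exact hnext.mono (by linarith)
    · refine hstep.isApprox_right hb hA hα hαs hlt subset_rfl hleT ?_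
      rw [hA.renormLength_eq] at hfin
      exact ne_top_of_le_ne_top hfin
        (lintegral_mono_set (Icc_subset_Icc ht0 (R.time_mono hT hj le_rfl)))
  have happIcc : ∀ τ ∈ Icc (t j) (t (j + 1)), IsApprox A α (g τ) (y (j + 1)) (X (j + 1)) := by
    intro τ hτ
    rcases hτ.2.eq_or_lt with heq | hlt
    · rw [heq]; exact happ'
    · exact happIco τ ⟨hτ.1, hlt⟩
  exact ⟨⟨hg, hg0, fun τ hτ => hmemT τ hτ, hX', happIcc, fun τ hτ =>
    hassoc τ hτ (happIcc τ hτ)⟩, hnext⟩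

theorem isApprox_of_run (hfin : renormLength A g (zeroPath A g t X y) 0 (t J) ≠ ⊤)
    (h0 : IsApprox A α (g (t 0)) (y 0) (X 0)) {j : ℕ} (hj : j ≤ J) :
    IsApprox A α (g (t j)) (y j) (X j) ∧
      IsAssociatedZero A (g (t j)) (y j) (X j) (zeroPath A g t X y (t j) - (0, y j)) := by
  induction j with
  | zero =>
    refine ⟨h0, ?_⟩
    obtain ⟨z, hz, -⟩ := hb.exists_associatedZero hA hα hαs
      (hg0 (t 0) ⟨R.start.ge, R.start.le.trans hT⟩) (hX 0 hj) h0
    have h1 : sInf {j : ℕ | t 0 ≤ t j} = 0 := Nat.sInf_eq_zero.2 (Or.inl (le_refl (t 0)))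
    rw [zeroPath_eq_of_tendsto h1 hz.tendsto, add_sub_cancel_left]
    exact hz
  | succ j ih =>
    obtain ⟨h1, h2⟩ := ih (by omega)
    obtain ⟨h3, -⟩ := isStep_of_run hb hA hα hαs hT hg hg0 R hX hfin hj h1 h2
    have h4 : t (j + 1) ∈ Icc (t j) (t (j + 1)) :=
      right_mem_Icc.2 (R.time_mono hT j.le_succ hj)
    exact ⟨h3.approx _ h4, h3.zero _ h4⟩

omit hX in
/-- A step that ends before time `T` has condition length at least `α / (64 K ^ 3)`: it ends
because `β μ` is about to exceed `α`, after a start with a much smaller value. -/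
theorem le_lintegral_of_time_lt {j : ℕ} (hj : j < J)
    (H : IsStep A α T g (y (j + 1)) (X (j + 1)) (zeroPath A g t X y) (Icc (t j) (t (j + 1))))
    (hnext : IsApprox A (α / 512) (g (t j)) (y (j + 1)) (X (j + 1))) (hlt : t (j + 1) < T) :
    ENNReal.ofReal (α / (64 * K ^ 3)) ≤ ∫⁻ τ in Icc (t j) (t (j + 1)),
      pathSpeed A g (zeroPath A g t X y) τ *
        (ENNReal.ofReal (pathGain A g (zeroPath A g t X y) τ))⁻¹ := by
  by_contra! hcon
  have htT := R.time_le hT hj.le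
  have h0 := R.time_nonneg hT (show j + 1 ≤ J from hj)
  have hhalf := H.isApprox_half hb hA hα hαs (R.time_succ hj htT).1 subset_rfl hnext hcon.le
  have hev := hA.eventually_isApprox hg.continuousOn hg0 ⟨h0, hlt.le⟩
    (show α / 2 < α by linarith) hhalf
  rw [eventually_nhdsWithin_iff, Metric.eventually_nhds_iff] at hev
  obtain ⟨ε, hε, hball⟩ := hev
  have hmin : min T (t (j + 1) + ε) ≤ t (j + 1) := by
    conv_rhs => rw [R.step j hj]
    refine le_csInf (insert_nonempty _ _) fun τ hτ => ?_
    rcases hτ with rfl | ⟨h1, h2, h3⟩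
    · exact min_le_left _ _
    · by_contra! hτlt
      have h4 : t (j + 1) ≤ τ := by
        rw [R.step j hj]
        exact csInf_le ⟨t j, fun x hx => R.le_of_mem htT hx⟩ (mem_insert_of_mem _ ⟨h1, h2, h3⟩)
      have h5 : τ < t (j + 1) + ε := hτlt.trans_le (min_le_right _ _)
      have h6 := hball (y := τ) (by rw [Real.dist_eq, abs_lt]; constructor <;> linarith)
        ⟨h0.trans h4, h2⟩
      exact absurd ((hA.beta_mul_mu_le_iff hα _ _ _).2 h6) (not_le.2 h3)
  rcases min_le_iff.1 hmin with h | h <;> linarith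

end Run

end

end PartialRenorm

theorem mainTheorem3 {l m : ℕ} (A : PartialRenorm.Supports l m)
    (hA : PartialRenorm.LocallyNondegenerate A) :
    ∃ c αstar ustar : ℝ, 1 ≤ c ∧ 0 < αstar ∧ 0 < ustar ∧
    ∀ α : ℝ, 0 < α → α ≤ αstar →
    ∃ C : ℝ, 0 ≤ C ∧
    ∀ (T : ℝ) (g : ℝ → PartialRenorm.System A), 0 ≤ T →
      ContDiffOn ℝ 1 g (Set.Icc 0 T) →
      (∀ τ ∈ Set.Icc 0 T, ∀ i, g τ i ≠ 0) →
    ∀ (J : ℕ) (t : ℕ → ℝ) (X : ℕ → Fin l → ℂ) (y : ℕ → Fin m → ℂ),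
      PartialRenorm.IsHomotopyRun A c α T g J t X y →
      ENNReal.ofReal c * PartialRenorm.beta A (g (t 0)) (y 0) (X 0) *
        PartialRenorm.mu A (g (t 0)) (y 0) (X 0) ≤ ENNReal.ofReal α →
      (∀ j ≤ J, ∀ k, ‖X j k‖ ≤ 1 / 4) →
      PartialRenorm.renormLength A g (PartialRenorm.zeroPath A g t X y) 0 (t J) ≠ ⊤ →
      -- (a) the invariant persists
      (∀ j ≤ J, ENNReal.ofReal c * PartialRenorm.beta A (g (t j)) (y j) (X j) *
        PartialRenorm.mu A (g (t j)) (y j) (X j) ≤ ENNReal.ofReal α) ∧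
      -- (b) the associated zeros exist and form a continuous path
      (∀ j ≤ J, PartialRenorm.IsAssociatedZero A (g (t j)) (y j) (X j)
        (PartialRenorm.zeroPath A g t X y (t j) - (0, y j))) ∧
      (∀ j < J, ∀ τ ∈ Set.Icc (t j) (t (j + 1)),
        PartialRenorm.IsAssociatedZero A (g τ) (y (j + 1)) (X (j + 1))
          (PartialRenorm.zeroPath A g t X y τ - (0, y (j + 1)))) ∧
      ContinuousOn (PartialRenorm.zeroPath A g t X y) (Set.Icc 0 (t J)) ∧
      -- (c) the path stays near infinity
      (∀ τ ∈ Set.Icc 0 (t J), ∀ k, ‖(PartialRenorm.zeroPath A g t X y τ).1 k‖ ≤ 1 / 2) ∧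
      -- (d) the next iterate stays close to the path, relative to the condition
      (∀ j < J, ∀ τ ∈ Set.Icc (t j) (t (j + 1)),
        PartialRenorm.mu A (g τ) (PartialRenorm.zeroPath A g t X y τ).2
            (PartialRenorm.zeroPath A g t X y τ).1 ≠ ⊤ ∧
        PartialRenorm.mu A (g τ) (PartialRenorm.zeroPath A g t X y τ).2
            (PartialRenorm.zeroPath A g t X y τ).1 *
          ENNReal.ofReal (PartialRenorm.omegaNorm A
            ((X (j + 1), y (j + 1)) - PartialRenorm.zeroPath A g t X y τ)) ≤
          ENNReal.ofReal ustar) ∧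
      -- (e) the number of steps is linear in the partially renormalized condition length
      (t J < T → (J : ENNReal) ≤ ENNReal.ofReal C *
        PartialRenorm.renormLength A g (PartialRenorm.zeroPath A g t X y) 0 (t J)) ∧
      ((∀ j < J, t j < T) → (J : ENNReal) ≤ 1 + ENNReal.ofReal C *
        PartialRenorm.renormLength A g (PartialRenorm.zeroPath A g t X y) 0 (t J)) := by
  obtain ⟨K, δ, hb⟩ := hA.exists_isRegularityBound
  have hK := hb.one_le
  have hδ := hb.delta_pos
  -- `c_** = 1` suffices: the constant of the support is absorbed into `α_*`
  refine ⟨1, δ / (4096 * K ^ 2), 1, le_rfl, by positivity, one_pos, fun α hα hαs => ?_⟩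
  refine ⟨64 * K ^ 3 / α, by positivity, fun T g hT hg hg0 J t X y R h0 hX hfin => ?_⟩
  rw [hA.beta_mul_mu_le_iff hα] at h0
  set ζ := PartialRenorm.zeroPath A g t X y with hζ
  have hinv := fun (j : ℕ) (hj : j ≤ J) =>
    PartialRenorm.isApprox_of_run hb hA hα hαs hT hg hg0 R hX hfin h0 hj
  have hstep := fun (j : ℕ) (hj : j < J) =>
    PartialRenorm.isStep_of_run hb hA hα hαs hT hg hg0 R hX hfin hj
      (hinv j hj.le).1 (hinv j hj.le).2
  have hmu : ∀ τ, PartialRenorm.mu A (g τ) (ζ τ).2 (ζ τ).1 =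
      (ENNReal.ofReal (PartialRenorm.pathGain A g ζ τ))⁻¹ := fun τ => hA.invNorm_eq _
  have hcount : ∀ n ≤ J, (∀ j < n, t (j + 1) < T) → (n : ENNReal) ≤
      ENNReal.ofReal (64 * K ^ 3 / α) * PartialRenorm.renormLength A g ζ 0 (t J) := by
    intro n hn hlt
    have h1 := R.mul_le_lintegral_of_steps hT hn fun j hj =>
      PartialRenorm.le_lintegral_of_time_lt hb hA hα hαs hT hg hg0 R (hj.trans_le hn)
        (hstep j (hj.trans_le hn)).1 (hstep j (hj.trans_le hn)).2 (hlt j hj)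
    rw [hA.renormLength_eq]
    have h2 : ENNReal.ofReal (64 * K ^ 3 / α) * ENNReal.ofReal (α / (64 * K ^ 3)) = 1 := by
      rw [← ENNReal.ofReal_mul (by positivity), ← ENNReal.ofReal_one]
      congr 1
      field_simp
    calc (n : ENNReal) = ENNReal.ofReal (64 * K ^ 3 / α) *
          (n * ENNReal.ofReal (α / (64 * K ^ 3))) := by
          rw [mul_left_comm, h2, mul_one]
      _ ≤ _ := by
          gcongr
          exact h1.trans (lintegral_mono_set (Icc_subset_Icc_right (R.time_mono hT hn le_rfl)))
  refine ⟨fun j hj => (hA.beta_mul_mu_le_iff hα _ _ _).2 (hinv j hj).1, fun j hj => (hinv j hj).2,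
    fun j hj => (hstep j hj).1.zero, ?_, fun τ hτ k => ?_, fun j hj τ hτ => ?_, fun hJT => ?_,
    fun hJT => ?_⟩
  · exact R.continuousOn_of_steps hT le_rfl fun j hj =>
      (hstep j hj).1.continuousOn hb hA hα hαs
  · have key : ∀ (v : Fin m → ℂ), ‖ζ τ - (0, v)‖ ≤ 1 / 2 → ‖(ζ τ).1 k‖ ≤ 1 / 2 := by
      intro v hv
      have h1 := (norm_le_pi_norm _ k).trans ((norm_fst_le (ζ τ - (0, v))).trans hv)
      simpa using h1
    rcases R.exists_mem_step le_rfl hτ with rfl | ⟨j, hj, hτj⟩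
    · have h1 : PartialRenorm.IsStep A α T g (y 0) (X 0) ζ {0} := by
        refine ⟨hg, hg0, by simpa using hT, hX 0 (Nat.zero_le _), ?_, ?_⟩ <;>
          rintro τ rfl
        · rw [← R.start]; exact h0
        · have h2 := (hinv 0 (Nat.zero_le _)).2
          rwa [R.start] at h2
      exact key _ (h1.norm_sub_le_half hb hA hα hαs (mem_singleton 0))
    · exact key _ ((hstep j hj).1.norm_sub_le_half hb hA hα hαs hτj)
  · obtain ⟨H, -⟩ := hstep j hj
    have hpos := H.pathGain_pos hb hA hα hαs hτ
    have hα1 := (hb.alpha_bounds hα hαs).1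
    obtain ⟨h1, -, h3⟩ := H.estimates hb hA hα hαs hτ
    have h4 := (H.approx τ hτ).le
    have hαK : α ≤ K * α := le_mul_of_one_le_left hα.le hK
    rw [hmu]
    refine ⟨by simpa using hpos, ?_⟩
    rw [← ENNReal.ofReal_inv_of_pos hpos, ← ENNReal.ofReal_mul (by positivity)]
    refine ENNReal.ofReal_le_ofReal ?_
    rw [inv_mul_le_iff₀ hpos, PartialRenorm.omegaNorm_eq, map_sub_rev, mul_one]
    have h5 : ζ τ - (X (j + 1), y (j + 1)) = ζ τ - (0, y (j + 1)) - (X (j + 1), 0) := by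
      rw [sub_sub]
      simp
    rw [h5]
    have h6 := mul_le_mul_of_nonneg_left h3 hα.le
    nlinarith
  · exact hcount J le_rfl fun j hj => (R.time_mono hT hj le_rfl).trans_lt hJT
  · rcases J with _ | n
    · simp
    · have h1 := hcount n n.le_succ fun j hj => hJT (j + 1) (by omega)
      rw [Nat.cast_succ, add_comm]
      gcongr
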